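/- Let $k\ge 1$ be an integer, let $\lambda=\frac{1}{120k^2}$, and let $n\ge \frac{16(2k-1)}{\lambda^2}$ be an integer. Let $G$ be a finite simple graph with $n$ vertices that does not contain $k$ pairwise vertex-disjoint cycles. Denote by $\rho(H)$ the spectral radius of a graph $H$, that is, the largest absolute value of an eigenvalue of the adjacency matrix of $H$, and by $S_{n,2k-1}$ the complete split graph, that is, the join of a clique on $2k-1$ vertices with an independent set of $n-2k+1$ vertices. Then $$\rho(G)\le \rho(S_{n,2k-1}),$$ with equality if and only if $G\cong S_{n,2k-1}$. -/

import Mathlib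

namespace SimpleGraph

/-- `G` contains `k` independent cycles: `k` cycles (closed walks of length at least three without
repeated vertices or edges, apart from the common endpoint), no two of which share a vertex. -/
def HasIndependentCycles {V : Type*} (G : SimpleGraph V) (k : ℕ) : Prop :=
  ∃ (v : Fin k → V) (c : ∀ i, G.Walk (v i) (v i)),
    (∀ i, (c i).IsCycle) ∧
      ∀ i j, i ≠ j → List.Disjoint (c i).support (c j).support

/-- The complete split graph on `n` vertices, the join of a clique on `s` vertices (those with
index less than `s`) with an independent set on the other `n - s` vertices (for `s ≤ n`). -/
def completeSplitGraph (n s : ℕ) : SimpleGraph (Fin n) where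
  Adj u v := u ≠ v ∧ (u.val < s ∨ v.val < s)
  symm := ⟨fun _ _ h => ⟨h.1.symm, h.2.symm⟩⟩
  loopless := ⟨fun _ h => h.1 rfl⟩

open Classical in
/-- The spectral radius of a finite graph: the maximum absolute value of an eigenvalue of its
adjacency matrix. (The matrix is real symmetric, so all its eigenvalues are real.) -/
noncomputable def adjSpectralRadius {V : Type*} [Fintype V] (G : SimpleGraph V) : ENNReal :=
  spectralRadius ℝ (G.adjMatrix ℝ)

end SimpleGraph

/-! Write `s = 2k - 1`. It suffices to show that a graph without `k` disjoint cycles whose spectral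
radius `r` is at least that of the split graph is the split graph; the inequality and the equality
case both follow.

The combinatorial input is an edge bound (`CyclicPacking.of_adjPairs`): every vertex set `S` spans
fewer than `s|S| + 6k²` edges. Cycles are handled through sets spanning at least as many edges as
vertices, so that disjoint cycles are produced by counting alone; such sets contain genuine cycles
because forests have too few edges.

Take a nonnegative eigenvector `x` for `r` with largest entry `1`, and call a vertex heavy if its
entry is at least `1/(16k)`. Since `r² ≥ s(n - s)`, while the edge bound limits two-step walks to
about `sn`, nearly all such walks alternate between heavy and light vertices, with an error of order
`n/k` (`error_le`). This forces every heavy entry to be at least `1/2` and every heavy vertex to see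
almost all light ones (`half_le_entry`, `degIn_heavy_ge`). Fewer than `s` heavy vertices would make
`r²` too small, and `2k` of them would share enough neighbours for `k` disjoint quadrilaterals, so
there are exactly `s` (`card_heavySet_eq`).

Finally the quadratic forms of `G` and of the split graph on the heavy set are compared at `x`
(`adjForm_add_le`). Joining a light vertex to a missing heavy neighbour gains more than is lost by
deleting the edges between light vertices, so the Rayleigh quotient cannot decrease; equality leaves
no room for a difference between the two graphs (`eq_splitOn`). -/

namespace SimpleGraph

open Finset
open scoped Classical

variable {V : Type*}

/-! ### Counting adjacent pairs, cyclic sets and packings -/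

/-- The entry of the adjacency matrix of `G` at `u`, `v`, as a real number. -/
noncomputable def adjInd (G : SimpleGraph V) (u v : V) : ℝ := if G.Adj u v then 1 else 0

/-- The number of neighbours of `v` in `T`, as a real number. -/
noncomputable def degIn (G : SimpleGraph V) (T : Finset V) (v : V) : ℝ := ∑ w ∈ T, G.adjInd v w

/-- The number of pairs in `S ×ˢ T` that are adjacent in `G`, as a real number. -/
noncomputable def adjPairs (G : SimpleGraph V) (S T : Finset V) : ℝ := ∑ u ∈ S, G.degIn T u

/-- A nonempty finite set of vertices spanning at least as many edges as it has vertices. -/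
def IsCyclicSet (G : SimpleGraph V) (W : Finset V) : Prop :=
  W.Nonempty ∧ 2 * (#W : ℝ) ≤ G.adjPairs W W

/-- `S` contains `k` pairwise disjoint cyclic sets. -/
def CyclicPacking (G : SimpleGraph V) : ℕ → Finset V → Prop
  | 0, _ => True
  | k + 1, S => ∃ W ⊆ S, G.IsCyclicSet W ∧ CyclicPacking G k (S \ W)

variable (G : SimpleGraph V)

lemma adjInd_comm (u v : V) : G.adjInd u v = G.adjInd v u := by simp [adjInd, G.adj_comm]

lemma adjInd_nonneg (u v : V) : 0 ≤ G.adjInd u v := by unfold adjInd; split_ifs <;> norm_num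

lemma adjInd_le_one (u v : V) : G.adjInd u v ≤ 1 := by unfold adjInd; split_ifs <;> norm_num

lemma adjInd_self (u : V) : G.adjInd u u = 0 := by simp [adjInd]

variable {G} in
lemma adjInd_of_adj {u v : V} (h : G.Adj u v) : G.adjInd u v = 1 := if_pos h

variable {G} in
lemma adjInd_of_not_adj {u v : V} (h : ¬ G.Adj u v) : G.adjInd u v = 0 := if_neg h

lemma degIn_nonneg (T : Finset V) (v : V) : 0 ≤ G.degIn T v :=
  sum_nonneg fun _ _ => G.adjInd_nonneg _ _

lemma degIn_le_card (T : Finset V) (v : V) : G.degIn T v ≤ #T := by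
  simpa [degIn] using sum_le_card_nsmul T (G.adjInd v) 1 fun _ _ => G.adjInd_le_one _ _

lemma degIn_mono {S T : Finset V} (h : S ⊆ T) (v : V) : G.degIn S v ≤ G.degIn T v :=
  sum_le_sum_of_subset_of_nonneg h fun _ _ _ => G.adjInd_nonneg _ _

lemma degIn_eq_card (T : Finset V) (v : V) : G.degIn T v = #{w ∈ T | G.Adj v w} := by
  simp [degIn, adjInd]

lemma degIn_insert {S : Finset V} {a : V} (h : a ∉ S) (v : V) :
    G.degIn (insert a S) v = G.adjInd v a + G.degIn S v := sum_insert h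

lemma degIn_singleton (a v : V) : G.degIn {a} v = G.adjInd v a := sum_singleton _ _

lemma adjPairs_nonneg (S T : Finset V) : 0 ≤ G.adjPairs S T :=
  sum_nonneg fun _ _ => G.degIn_nonneg _ _

lemma adjPairs_comm (S T : Finset V) : G.adjPairs S T = G.adjPairs T S := by
  simp only [adjPairs, degIn]
  rw [sum_comm]
  exact sum_congr rfl fun _ _ => sum_congr rfl fun _ _ => G.adjInd_comm _ _

lemma adjPairs_mono {S S' T T' : Finset V} (h : S ⊆ S') (h' : T ⊆ T') :
    G.adjPairs S T ≤ G.adjPairs S' T' :=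
  (sum_le_sum fun _ _ => G.degIn_mono h' _).trans
    (sum_le_sum_of_subset_of_nonneg h fun _ _ _ => G.degIn_nonneg _ _)

lemma adjPairs_union_left {S T : Finset V} (h : Disjoint S T) (U : Finset V) :
    G.adjPairs (S ∪ T) U = G.adjPairs S U + G.adjPairs T U := sum_union h

lemma adjPairs_union_right (U : Finset V) {S T : Finset V} (h : Disjoint S T) :
    G.adjPairs U (S ∪ T) = G.adjPairs U S + G.adjPairs U T := by
  rw [adjPairs_comm, adjPairs_union_left G h, adjPairs_comm G S, adjPairs_comm G T]

lemma adjPairs_union_self {S T : Finset V} (h : Disjoint S T) :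
    G.adjPairs (S ∪ T) (S ∪ T) = G.adjPairs S S + 2 * G.adjPairs S T + G.adjPairs T T := by
  rw [adjPairs_union_left G h, adjPairs_union_right G _ h, adjPairs_union_right G _ h,
    adjPairs_comm G T S]
  ring

lemma adjPairs_insert_self {S : Finset V} {a : V} (h : a ∉ S) :
    G.adjPairs (insert a S) (insert a S) = G.adjPairs S S + 2 * G.degIn S a := by
  rw [insert_eq, adjPairs_union_self G (by simpa using h)]
  simp [adjPairs, degIn_singleton, adjInd_self]
  ring

lemma adjPairs_sdiff_self {S T : Finset V} (h : S ⊆ T) :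
    G.adjPairs (T \ S) (T \ S) = G.adjPairs T T - 2 * G.adjPairs S T + G.adjPairs S S := by
  have h1 := adjPairs_union_self G (disjoint_sdiff : Disjoint S (T \ S))
  have h2 := adjPairs_union_right G S (disjoint_sdiff : Disjoint S (T \ S))
  rw [union_sdiff_of_subset h] at h1 h2
  linarith

lemma adjPairs_singleton_left (a : V) (S : Finset V) : G.adjPairs {a} S = G.degIn S a :=
  sum_singleton _ _

lemma adjPairs_pair_left {a b : V} (h : a ≠ b) (S : Finset V) :
    G.adjPairs {a, b} S = G.degIn S a + G.degIn S b := sum_pair h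

lemma adjPairs_pair_self {a b : V} (h : a ≠ b) :
    G.adjPairs {a, b} {a, b} = 2 * G.adjInd a b := by
  rw [adjPairs_insert_self G (by simpa using h), adjPairs_singleton_left, degIn_singleton,
    degIn_singleton, adjInd_self]
  ring

variable {G}

lemma exists_adj_of_adjPairs_pos {S T : Finset V} (h : 0 < G.adjPairs S T) :
    ∃ u ∈ S, ∃ v ∈ T, G.Adj u v := by
  by_contra! hc
  refine h.ne' (sum_eq_zero fun u hu => sum_eq_zero fun v hv => adjInd_of_not_adj (hc u hu v hv))

lemma exists_adj_of_degIn_pos {T : Finset V} {u : V} (h : 0 < G.degIn T u) :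
    ∃ v ∈ T, G.Adj u v := by
  by_contra! hc
  exact h.ne' (sum_eq_zero fun v hv => adjInd_of_not_adj (hc v hv))

lemma one_le_degIn {T : Finset V} {u v : V} (hv : v ∈ T) (h : G.Adj u v) : 1 ≤ G.degIn T u := by
  rw [← adjInd_of_adj h]
  exact single_le_sum (fun w _ => G.adjInd_nonneg u w) hv

lemma CyclicPacking.mono {k : ℕ} {S T : Finset V} (h : G.CyclicPacking k S) (hST : S ⊆ T) :
    G.CyclicPacking k T := by
  induction k generalizing S T with
  | zero => trivial
  | succ k ih =>
    obtain ⟨W, hW, hc, hp⟩ := h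
    exact ⟨W, hW.trans hST, hc, ih hp (sdiff_subset_sdiff hST subset_rfl)⟩

lemma CyclicPacking.succ_of_disjoint {k : ℕ} {S T W : Finset V} (h : G.CyclicPacking k S)
    (hW : G.IsCyclicSet W) (hST : S ⊆ T) (hWT : W ⊆ T) (hd : Disjoint W S) :
    G.CyclicPacking (k + 1) T :=
  ⟨W, hWT, hW, h.mono fun _ hx => mem_sdiff.2 ⟨hST hx, fun hxW => Finset.disjoint_left.1 hd hxW hx⟩⟩

lemma isCyclicSet_triangle {a b c : V} (hab : G.Adj a b) (hac : G.Adj a c) (hbc : G.Adj b c) :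
    G.IsCyclicSet {a, b, c} := by
  refine ⟨by simp, ?_⟩
  rw [adjPairs_insert_self G (by simp [hab.ne, hac.ne]), adjPairs_pair_self G hbc.ne,
    degIn_insert G (by simpa using hbc.ne), degIn_singleton, adjInd_of_adj hab, adjInd_of_adj hac,
    adjInd_of_adj hbc, card_eq_three.2 ⟨a, b, c, hab.ne, hac.ne, hbc.ne, rfl⟩]
  norm_num

lemma isCyclicSet_square {a b p q : V} (hab : a ≠ b) (hpq : p ≠ q) (hap : G.Adj a p)
    (haq : G.Adj a q) (hbp : G.Adj b p) (hbq : G.Adj b q) : G.IsCyclicSet {a, b, p, q} := by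
  refine ⟨by simp, ?_⟩
  rw [adjPairs_insert_self G (by simp [hab, hap.ne, haq.ne]),
    adjPairs_insert_self G (by simp [hbp.ne, hbq.ne]), adjPairs_pair_self G hpq,
    degIn_insert G (a := b) (by simp [hbp.ne, hbq.ne]),
    degIn_insert G (a := p) (by simpa using hpq), degIn_insert G (a := p) (by simpa using hpq),
    degIn_singleton, degIn_singleton, adjInd_of_adj hap, adjInd_of_adj haq, adjInd_of_adj hbp,
    adjInd_of_adj hbq, card_insert_of_notMem (by simp [hab, hap.ne, haq.ne]),
    card_insert_of_notMem (by simp [hbp.ne, hbq.ne]), card_pair hpq]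
  have h1 := G.adjInd_nonneg a b
  have h2 := G.adjInd_nonneg p q
  norm_num
  linarith

lemma IsCyclicSet.three_le_card {W : Finset V} (h : G.IsCyclicSet W) : 3 ≤ #W := by
  by_contra! hc
  obtain ⟨v, hv⟩ := h.1
  have h1 : G.adjPairs W W ≤ #W * ((#W : ℝ) - 1) := by
    have : ∀ v ∈ W, G.degIn W v ≤ (#W : ℝ) - 1 := by
      intro v hv
      have := G.degIn_insert (notMem_erase v W) v
      rw [insert_erase hv, adjInd_self] at this
      have h3 := G.degIn_le_card (W.erase v) v
      rw [card_erase_of_mem hv, Nat.cast_sub (card_pos.2 ⟨v, hv⟩)] at h3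
      push_cast at h3
      linarith
    simpa [adjPairs] using sum_le_card_nsmul W (G.degIn W) _ this
  have h2 := h.2
  have h3 : (0 : ℝ) < #W := by exact_mod_cast card_pos.2 h.1
  have h4 : (#W : ℝ) < 3 := by exact_mod_cast hc
  nlinarith

/-! ### Minimal cyclic sets -/

/-- A cyclic set of least size among those contained in `S`. -/
def IsMinCyclicSet (G : SimpleGraph V) (S W : Finset V) : Prop :=
  W ⊆ S ∧ G.IsCyclicSet W ∧ ∀ U ⊆ S, G.IsCyclicSet U → #W ≤ #U

lemma IsCyclicSet.exists_isMinCyclicSet {S : Finset V} (h : G.IsCyclicSet S) :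
    ∃ W, G.IsMinCyclicSet S W := by
  obtain ⟨W, hW, hmin⟩ := exists_min_image (S.powerset.filter G.IsCyclicSet) card
    ⟨S, by simp [h]⟩
  simp only [mem_filter, mem_powerset] at hW hmin
  exact ⟨W, hW.1, hW.2, fun U hU hc => hmin U ⟨hU, hc⟩⟩

lemma exists_adjPairs_self_eq_two_mul (S : Finset V) : ∃ N : ℕ, G.adjPairs S S = 2 * N := by
  induction S using Finset.induction_on with
  | empty => exact ⟨0, by simp [adjPairs]⟩
  | insert a S ha ih =>
    obtain ⟨N, hN⟩ := ih
    refine ⟨N + #{w ∈ S | G.Adj a w}, ?_⟩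
    rw [adjPairs_insert_self G ha, hN, degIn_eq_card]
    push_cast
    ring

lemma adjPairs_erase_self {S : Finset V} {v : V} (hv : v ∈ S) :
    G.adjPairs (S.erase v) (S.erase v) = G.adjPairs S S - 2 * G.degIn S v := by
  have h := adjPairs_insert_self G (notMem_erase v S)
  have h' := G.degIn_insert (notMem_erase v S) v
  rw [insert_erase hv] at h h'
  rw [adjInd_self] at h'
  linarith

/-- A minimal cyclic set behaves like an induced cycle. If `W` spans `N` edges, deleting `v` must
destroy cyclicity, so every degree is at least `N - #W + 2`. Summing gives `(#W - 2)(N - #W) ≤ 0`,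
hence `N = #W`; the degrees are then at least two and average two. -/
lemma IsMinCyclicSet.degIn_eq_two {S W : Finset V} (h : G.IsMinCyclicSet S W) {v : V}
    (hv : v ∈ W) : G.degIn W v = 2 := by
  obtain ⟨hWS, hc, hmin⟩ := h
  have h3 : (3 : ℝ) ≤ #W := by exact_mod_cast hc.three_le_card
  obtain ⟨N, hN⟩ := exists_adjPairs_self_eq_two_mul (G := G) W
  have hNW : #W ≤ N := by
    have := hc.2
    rw [hN] at this
    exact_mod_cast (mul_le_mul_iff_right₀ (two_pos : (0 : ℝ) < 2)).1 this
  have hNW' : (#W : ℝ) ≤ N := by exact_mod_cast hNW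
  have key : ∀ v ∈ W, (N : ℝ) - #W + 2 ≤ G.degIn W v := by
    intro v hv
    by_contra! hlt
    have hcard : (#(W.erase v) : ℝ) = #W - 1 := by
      rw [card_erase_of_mem hv, Nat.cast_sub (card_pos.2 ⟨v, hv⟩)]; simp
    have hne : (W.erase v).Nonempty := by
      rw [← card_pos]
      have : (0 : ℝ) < #(W.erase v) := by rw [hcard]; linarith
      exact_mod_cast this
    have hlt' : G.degIn W v ≤ (N : ℝ) - #W + 1 := by
      rw [degIn_eq_card] at hlt ⊢
      have : #{w ∈ W | G.Adj v w} + #W < N + 2 := by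
        have : ((#{w ∈ W | G.Adj v w} : ℕ) : ℝ) + #W < N + 2 := by linarith
        exact_mod_cast this
      have : ((#{w ∈ W | G.Adj v w} : ℕ) : ℝ) + #W ≤ N + 1 := by
        exact_mod_cast Nat.lt_succ_iff.1 this
      linarith
    have := hmin (W.erase v) ((erase_subset _ _).trans hWS) ⟨hne, by
      rw [hcard, adjPairs_erase_self hv, hN]; linarith⟩
    have : (#W : ℝ) ≤ #(W.erase v) := by exact_mod_cast this
    linarith
  have hsum : (#W : ℝ) * (N - #W + 2) ≤ 2 * N := by
    have := card_nsmul_le_sum W (G.degIn W) _ key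
    rw [nsmul_eq_mul] at this
    rw [← hN]
    exact this
  have hNeq : (N : ℝ) = #W := by nlinarith
  have hz : ∑ w ∈ W, (G.degIn W w - 2) = 0 := by
    rw [sum_sub_distrib, ← adjPairs, hN, hNeq]; simp; ring
  have := (sum_eq_zero_iff_of_nonneg fun w hw => by
    have := key w hw; rw [hNeq] at this; linarith).1 hz v hv
  linarith

lemma IsMinCyclicSet.adjPairs_left {S W : Finset V} (h : G.IsMinCyclicSet S W) {U : Finset V}
    (hU : U ⊆ W) : G.adjPairs U W = 2 * #U := by
  rw [adjPairs, sum_congr rfl fun v hv => h.degIn_eq_two (hU hv)]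
  simp [mul_comm]

/-- Connectedness: with no edge leaving it, `U` would keep all its degrees equal to two and be a
smaller cyclic set. -/
lemma IsMinCyclicSet.exists_adj_sdiff {S W : Finset V} (h : G.IsMinCyclicSet S W) {U : Finset V}
    (hU : U ⊂ W) (hne : U.Nonempty) : ∃ v ∈ W \ U, 1 ≤ G.degIn U v := by
  have hU' := h.adjPairs_left hU.1
  have h1 := adjPairs_union_right G U (disjoint_sdiff : Disjoint U (W \ U))
  rw [union_sdiff_of_subset hU.1] at h1
  by_cases hpos : 0 < G.adjPairs U (W \ U)
  · obtain ⟨u, hu, v, hv, huv⟩ := exists_adj_of_adjPairs_pos hpos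
    exact ⟨v, hv, one_le_degIn hu huv.symm⟩
  · have := h.2.2 U (hU.1.trans h.1) ⟨hne, by linarith⟩
    exact absurd (card_lt_card hU) this.not_gt

/-- A minimal cyclic set with four vertices adjacent to both `a` and `b` splits into two cyclic
sets, one through `a` and one through `b`. -/
lemma IsMinCyclicSet.exists_split {S W P : Finset V} (h : G.IsMinCyclicSet S W) {a b : V}
    (ha : a ∉ W) (hb : b ∉ W) (hPa : ∀ p ∈ P, G.Adj a p) (hPb : ∀ p ∈ P, G.Adj b p)
    (hP : 4 ≤ #(P ∩ W)) :
    ∃ U ⊆ W, G.IsCyclicSet (insert a U) ∧ G.IsCyclicSet (insert b (W \ U)) := by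
  -- These sets have at least `#U - 1` edges, as a path has. A largest one, grown from a single
  -- vertex along edges of `W`, meets `P` in exactly two points.
  let F := W.powerset.filter fun U =>
    U.Nonempty ∧ 2 * (#U : ℝ) - 2 ≤ G.adjPairs U U ∧ #(P ∩ U) ≤ 2
  obtain ⟨w, hw⟩ := h.2.1.1
  obtain ⟨U, hUF, hmax⟩ := exists_max_image F card ⟨{w}, by
    have : #(P ∩ {w}) ≤ 1 := (card_le_card inter_subset_right).trans (by simp)
    simp only [F, mem_filter, mem_powerset, singleton_subset_iff, hw, singleton_nonempty,
      card_singleton, true_and]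
    exact ⟨by have := G.adjPairs_nonneg {w} {w}; norm_num; exact this, by omega⟩⟩
  simp only [F, mem_filter, mem_powerset] at hUF hmax
  obtain ⟨hUW, hUne, hUe, hUP⟩ := hUF
  have hssub : U ⊂ W := hUW.ssubset_of_ne (by rintro rfl; omega)
  obtain ⟨v, hv, hvd⟩ := h.exists_adj_sdiff hssub hUne
  rw [mem_sdiff] at hv
  have hPU : #(P ∩ U) = 2 := by
    by_contra hne
    have h1 : #(P ∩ insert v U) ≤ 2 := by
      have : P ∩ insert v U ⊆ insert v (P ∩ U) := by
        intro x; simp only [mem_inter, mem_insert]; tauto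
      have := (card_le_card this).trans (card_insert_le _ _)
      omega
    have := hmax (insert v U) ⟨insert_subset hv.1 hUW, insert_nonempty _ _, by
      rw [card_insert_of_notMem hv.2, adjPairs_insert_self G hv.2]; push_cast; linarith, h1⟩
    rw [card_insert_of_notMem hv.2] at this
    omega
  -- As all degrees in `W` are two, the complementary arc inherits the same bound, so each arc
  -- becomes cyclic once a vertex with two neighbours in it is added.
  have hcompl : 2 * (#(W \ U) : ℝ) - 2 ≤ G.adjPairs (W \ U) (W \ U) := by
    have hc : (#(W \ U) : ℝ) + #U = #W := by exact_mod_cast card_sdiff_add_card_eq_card hUW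
    rw [adjPairs_sdiff_self G hUW, h.adjPairs_left hUW, h.adjPairs_left subset_rfl]
    linarith
  have hPc : 2 ≤ #(P ∩ (W \ U)) := by
    have : P ∩ W ⊆ (P ∩ U) ∪ (P ∩ (W \ U)) := by
      intro x; simp only [mem_inter, mem_union, mem_sdiff]; tauto
    have := (card_le_card this).trans (card_union_le _ _)
    omega
  have hdeg : ∀ (c : V) (T : Finset V), (∀ p ∈ P, G.Adj c p) → 2 ≤ #(P ∩ T) →
      2 ≤ G.degIn T c := by
    intro c T hc hT
    rw [degIn_eq_card]
    have : P ∩ T ⊆ T.filter (G.Adj c) := fun x hx => by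
      rw [mem_inter] at hx; exact mem_filter.2 ⟨hx.2, hc x hx.1⟩
    exact_mod_cast hT.trans (card_le_card this)
  have hcyc : ∀ (c : V) (T : Finset V), c ∉ T → (∀ p ∈ P, G.Adj c p) → 2 ≤ #(P ∩ T) →
      2 * (#T : ℝ) - 2 ≤ G.adjPairs T T → G.IsCyclicSet (insert c T) := by
    intro c T hcT hc hT hE
    refine ⟨insert_nonempty _ _, ?_⟩
    have := hdeg c T hc hT
    rw [card_insert_of_notMem hcT, adjPairs_insert_self G hcT]
    push_cast
    linarith
  exact ⟨U, hUW, hcyc a U (fun h => ha (hUW h)) hPa hPU.ge hUe,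
    hcyc b _ (fun h => hb (mem_sdiff.1 h).1) hPb hPc hcompl⟩

/-- Two vertices with many common neighbours increase the size of a packing by one. -/
lemma CyclicPacking.insert_pair {j : ℕ} {S P : Finset V} (h : G.CyclicPacking j S) {a b : V}
    (hab : a ≠ b) (ha : a ∉ S) (hb : b ∉ S) (hPa : ∀ p ∈ P, G.Adj a p)
    (hPb : ∀ p ∈ P, G.Adj b p) (hP : 3 * j + 2 ≤ #(P ∩ S)) :
    G.CyclicPacking (j + 1) (insert a (insert b S)) := by
  induction j generalizing S with
  | zero =>
    obtain ⟨p, hp, q, hq, hpq⟩ := one_lt_card.1 (show 1 < #(P ∩ S) by omega)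
    rw [mem_inter] at hp hq
    refine ⟨{a, b, p, q}, ?_, isCyclicSet_square hab hpq (hPa _ hp.1) (hPa _ hq.1) (hPb _ hp.1)
      (hPb _ hq.1), trivial⟩
    intro x
    simp only [mem_insert, mem_singleton]
    rintro (rfl | rfl | rfl | rfl) <;> simp [*]
  | succ j ih =>
    obtain ⟨W₀, hW₀, hc, hp⟩ := h
    obtain ⟨W, hW⟩ := hc.exists_isMinCyclicSet
    have hWS := hW.1.trans hW₀
    replace hp := hp.mono (sdiff_subset_sdiff subset_rfl hW.1)
    by_cases h4 : 4 ≤ #(P ∩ W)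
    · obtain ⟨U, hUW, h1, h2⟩ := hW.exists_split (fun h => ha (hWS h)) (fun h => hb (hWS h))
        hPa hPb h4
      have hbp : G.CyclicPacking (j + 1) (insert b (S \ U)) := by
        refine hp.succ_of_disjoint h2 ?_ ?_ ?_
        · exact (sdiff_subset_sdiff subset_rfl hUW).trans (subset_insert _ _)
        · exact insert_subset_insert _ (sdiff_subset_sdiff hWS subset_rfl)
        · rw [disjoint_insert_left]
          refine ⟨fun h => hb (mem_sdiff.1 h).1, ?_⟩
          exact Finset.disjoint_left.2 fun x hx hx' => (mem_sdiff.1 hx').2 (mem_sdiff.1 hx).1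
      refine hbp.succ_of_disjoint h1 ?_ ?_ ?_
      · exact (insert_subset_insert _ sdiff_subset).trans (subset_insert _ _)
      · exact insert_subset_insert _ ((hUW.trans hWS).trans (subset_insert _ _))
      · refine Finset.disjoint_left.2 fun x hx hx' => ?_
        simp only [mem_insert, mem_sdiff] at hx hx'
        rcases hx with rfl | hx <;> rcases hx' with rfl | hx'
        · exact hab rfl
        · exact ha hx'.1
        · exact hb (hWS (hUW hx))
        · exact hx'.2 hx
    -- Here `W` contains at most three points of `P`, exactly what the bound `3j + 2` gives up when
    -- `j` drops by one.
    · have : 3 * j + 2 ≤ #(P ∩ (S \ W)) := by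
        have : P ∩ S ⊆ (P ∩ W) ∪ (P ∩ (S \ W)) := by
          intro x; simp only [mem_inter, mem_union, mem_sdiff]; tauto
        have := (card_le_card this).trans (card_union_le _ _)
        omega
      refine (ih hp (fun h => ha (mem_sdiff.1 h).1) (fun h => hb (mem_sdiff.1 h).1)
        this).succ_of_disjoint hW.2.1 ?_ ?_ ?_
      · exact insert_subset_insert _ (insert_subset_insert _ sdiff_subset)
      · exact hWS.trans ((subset_insert _ _).trans (subset_insert _ _))
      · refine Finset.disjoint_left.2 fun x hx hx' => ?_
        simp only [mem_insert, mem_sdiff] at hx'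
        rcases hx' with rfl | rfl | hx'
        · exact ha (hWS hx)
        · exact hb (hWS hx)
        · exact hx'.2 hx

end SimpleGraph

/-! ### The edge bound, and packings yield cycles -/

namespace SimpleGraph

open Finset
open scoped Classical

variable {V : Type*} {G : SimpleGraph V}

lemma degIn_erase {T : Finset V} {a : V} (ha : a ∈ T) (v : V) :
    G.degIn (T.erase a) v = G.degIn T v - G.adjInd v a := by
  have := G.degIn_insert (notMem_erase a T) v
  rw [insert_erase ha] at this
  linarith

lemma add_one_le_degIn_of_lt {T : Finset V} {v : V} {m : ℕ} (h : (m : ℝ) < G.degIn T v) :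
    (m : ℝ) + 1 ≤ G.degIn T v := by
  rw [degIn_eq_card] at h ⊢
  exact_mod_cast h

/-- Given three neighbours of `v` in `W`, remove an edge `ab` of `W` with both its ends and insert
`v`. Since `S` is triangle-free, `v` misses `a` or `b` and keeps two neighbours. The result has `#W
- 1` vertices and at least `(#W - 3) + 2` edges, against minimality. -/
lemma IsMinCyclicSet.degIn_le_two {S W : Finset V} (h : G.IsMinCyclicSet S W)
    (htf : ∀ a ∈ S, ∀ b ∈ S, ∀ c ∈ S, G.Adj a b → G.Adj a c → ¬ G.Adj b c) {v : V}
    (hv : v ∈ S \ W) : G.degIn W v ≤ 2 := by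
  by_contra! hlt
  have h3 : (3 : ℝ) ≤ G.degIn W v := by
    have := add_one_le_degIn_of_lt (m := 2) (by exact_mod_cast hlt)
    push_cast at this; linarith
  rw [mem_sdiff] at hv
  obtain ⟨a, ha⟩ := h.2.1.1
  obtain ⟨b, hb, hab⟩ := exists_adj_of_degIn_pos (by rw [h.degIn_eq_two ha]; norm_num)
  have hbe : b ∈ W.erase a := mem_erase.2 ⟨hab.ne', hb⟩
  have hvU : v ∉ (W.erase a).erase b := fun hm => hv.2 (mem_of_mem_erase (mem_of_mem_erase hm))
  have hind : G.adjInd v a + G.adjInd v b ≤ 1 := by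
    by_cases hva : G.Adj v a
    · rw [adjInd_of_adj hva, adjInd_of_not_adj
        (htf a (h.1 ha) v hv.1 b (h.1 hb) hva.symm hab)]
      norm_num
    · rw [adjInd_of_not_adj hva]
      linarith [G.adjInd_le_one v b]
  have hcard : #((W.erase a).erase b) + 2 = #W := by
    rw [card_erase_of_mem hbe, card_erase_of_mem ha]
    have := h.2.1.three_le_card
    omega
  have hcard' : (#((W.erase a).erase b) : ℝ) + 2 = #W := by exact_mod_cast hcard
  have hE : G.adjPairs ((W.erase a).erase b) ((W.erase a).erase b) = 2 * #W - 6 := by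
    rw [adjPairs_erase_self hbe, adjPairs_erase_self ha, degIn_erase ha, h.degIn_eq_two ha,
      h.degIn_eq_two hb, adjInd_of_adj hab.symm, h.adjPairs_left subset_rfl]
    ring
  have hmin := h.2.2 (insert v ((W.erase a).erase b))
    (insert_subset hv.1 (((erase_subset _ _).trans (erase_subset _ _)).trans h.1))
    ⟨insert_nonempty _ _, by
      rw [card_insert_of_notMem hvU, adjPairs_insert_self G hvU, hE, degIn_erase hbe,
        degIn_erase ha]
      push_cast
      linarith⟩
  rw [card_insert_of_notMem hvU] at hmin
  omega

lemma nonempty_of_adjPairs_pos {S T : Finset V} (h : 0 < G.adjPairs S T) : S.Nonempty := by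
  obtain ⟨u, hu, -⟩ := exists_adj_of_adjPairs_pos h
  exact ⟨u, hu⟩

/-- The total degree of a triangle is at most the number of vertices plus the codegrees. -/
lemma degIn_add_degIn_add_degIn_le (S : Finset V) (a b c : V) :
    G.degIn S a + G.degIn S b + G.degIn S c ≤ #S + #{w ∈ S | G.Adj a w ∧ G.Adj b w} +
      #{w ∈ S | G.Adj a w ∧ G.Adj c w} + #{w ∈ S | G.Adj b w ∧ G.Adj c w} := by
  simp only [degIn_eq_card]
  simp only [Finset.card_filter, Finset.card_eq_sum_ones S]
  push_cast
  simp only [← sum_add_distrib]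
  refine sum_le_sum fun w _ => ?_
  by_cases h1 : G.Adj a w <;> by_cases h2 : G.Adj b w <;> by_cases h3 : G.Adj c w <;>
    simp [h1, h2, h3]

/-- A weak form of the Erdős–Pósa edge bound: a set spanning at least
`(2k - 1) n + 6 k ^ 2` edges on `n` vertices contains `k` disjoint cyclic sets. -/
theorem CyclicPacking.of_adjPairs {k : ℕ} (hk : 1 ≤ k) {S : Finset V}
    (h : 2 * (2 * (k : ℝ) - 1) * #S + 12 * (k : ℝ) ^ 2 ≤ G.adjPairs S S) :
    G.CyclicPacking k S := by
  induction k, hk using Nat.le_induction generalizing S with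
  | base =>
    norm_num at h
    have hc : (0 : ℝ) ≤ #S := Nat.cast_nonneg _
    exact ⟨S, subset_rfl, ⟨nonempty_of_adjPairs_pos (G := G) (T := S) (by linarith), by linarith⟩,
      trivial⟩
  | succ k hk ih =>
    have hk1 : (1 : ℝ) ≤ k := by exact_mod_cast hk
    have hc : (0 : ℝ) ≤ #S := Nat.cast_nonneg _
    push_cast at h
    have hcyc : G.IsCyclicSet S :=
      ⟨nonempty_of_adjPairs_pos (G := G) (T := S) (by nlinarith), by nlinarith⟩
    by_cases htf : ∀ a ∈ S, ∀ b ∈ S, ∀ c ∈ S, G.Adj a b → G.Adj a c → ¬ G.Adj b c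
    · obtain ⟨W, hW⟩ := hcyc.exists_isMinCyclicSet
      -- Without triangles, removing `W` costs at most `2 #W + 4 #(S \ W)` ordered pairs, covered by
      -- the `4 #S` by which the threshold falls from `k + 1` to `k`.
      refine ⟨W, hW.1, hW.2.1, ih ?_⟩
      have h1 : G.adjPairs (S \ W) W ≤ 2 * #(S \ W) := by
        have := sum_le_card_nsmul (S \ W) (G.degIn W) 2 fun v hv => hW.degIn_le_two htf hv
        rw [nsmul_eq_mul] at this
        rw [mul_comm]; exact this
      have h2 := adjPairs_union_self G (disjoint_sdiff : Disjoint W (S \ W))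
      rw [union_sdiff_of_subset hW.1, hW.adjPairs_left subset_rfl, adjPairs_comm] at h2
      have h3 : (#(S \ W) : ℝ) + #W = #S := by exact_mod_cast card_sdiff_add_card_eq_card hW.1
      have h4 : (0 : ℝ) ≤ #W := Nat.cast_nonneg _
      rw [adjPairs_comm G W] at h2
      nlinarith
    · push Not at htf
      obtain ⟨a, ha, b, hb, c, hcS, hab, hac, hbc⟩ := htf
      -- Deleting two vertices costs at most `4 #S` ordered pairs, so `k` cyclic sets remain, and
      -- the deleted pair supplies one more.
      have hpair : ∀ a ∈ S, ∀ b ∈ S, G.Adj a b →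
          3 * k + 2 ≤ #{w ∈ S | G.Adj a w ∧ G.Adj b w} → G.CyclicPacking (k + 1) S := by
        intro a ha b hb hab hP
        have hsub : ({a, b} : Finset V) ⊆ S := by
          intro x; simp only [mem_insert, mem_singleton]; rintro (rfl | rfl) <;> assumption
        have hS : insert a (insert b (S \ {a, b})) = S := by
          ext x
          simp only [mem_insert, mem_sdiff, mem_singleton]
          constructor
          · rintro (rfl | rfl | h) <;> tauto
          · tauto
        rw [← hS]
        refine CyclicPacking.insert_pair (P := {w ∈ S | G.Adj a w ∧ G.Adj b w}) (ih ?_) hab.ne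
          (by simp) (by simp) (fun p hp => (mem_filter.1 hp).2.1)
          (fun p hp => (mem_filter.1 hp).2.2) ?_
        · have h1 := adjPairs_sdiff_self G hsub
          rw [adjPairs_pair_left G hab.ne, adjPairs_pair_self G hab.ne] at h1
          have h2 := G.degIn_le_card S a
          have h3 := G.degIn_le_card S b
          have h4 := G.adjInd_nonneg a b
          have h5 : (#(S \ {a, b}) : ℝ) ≤ #S := by exact_mod_cast card_le_card sdiff_subset
          nlinarith
        · refine hP.trans (card_le_card fun w hw => ?_)
          have hw' := mem_filter.1 hw
          simp only [mem_inter, hw, mem_sdiff, hw'.1, mem_insert, mem_singleton, true_and]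
          rintro (rfl | rfl)
          · exact G.loopless.irrefl _ hw'.2.1
          · exact G.loopless.irrefl _ hw'.2.2
      by_cases h1 : 3 * k + 2 ≤ #{w ∈ S | G.Adj a w ∧ G.Adj b w}
      · exact hpair a ha b hb hab h1
      by_cases h2 : 3 * k + 2 ≤ #{w ∈ S | G.Adj a w ∧ G.Adj c w}
      · exact hpair a ha c hcS hac h2
      by_cases h3 : 3 * k + 2 ≤ #{w ∈ S | G.Adj b w ∧ G.Adj c w}
      · exact hpair b hb c hcS hbc h3
      have hT : ({a, b, c} : Finset V) ⊆ S := by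
        intro x; simp only [mem_insert, mem_singleton]; rintro (rfl | rfl | rfl) <;> assumption
      -- All three codegrees are small, so the triangle has degree sum at most `#S + 9k + 6`.
      -- Removing it costs at most `2 #S + 18k + 12` ordered pairs; the quadratic term of the
      -- threshold alone yields `24k + 12`.
      refine ⟨{a, b, c}, hT, isCyclicSet_triangle hab hac hbc, ih ?_⟩
      have e1 : (#{w ∈ S | G.Adj a w ∧ G.Adj b w} : ℝ) ≤ 3 * k + 2 := by
        exact_mod_cast (not_le.1 h1).le
      have e2 : (#{w ∈ S | G.Adj a w ∧ G.Adj c w} : ℝ) ≤ 3 * k + 2 := by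
        exact_mod_cast (not_le.1 h2).le
      have e3 : (#{w ∈ S | G.Adj b w ∧ G.Adj c w} : ℝ) ≤ 3 * k + 2 := by
        exact_mod_cast (not_le.1 h3).le
      have e4 := degIn_add_degIn_add_degIn_le (G := G) S a b c
      have e5 := adjPairs_sdiff_self G hT
      have e6 : G.adjPairs {a, b, c} S = G.degIn S a + (G.degIn S b + G.degIn S c) := by
        rw [adjPairs, sum_insert (by simp [hab.ne, hac.ne]), sum_pair hbc.ne]
      have e7 := G.adjPairs_nonneg {a, b, c} {a, b, c}
      have e8 : (#(S \ {a, b, c}) : ℝ) ≤ #S := by exact_mod_cast card_le_card sdiff_subset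
      nlinarith

lemma adjPairs_self_lt_of_not_cyclicPacking {k : ℕ} (hk : 1 ≤ k) {S T : Finset V} (hST : S ⊆ T)
    (h : ¬ G.CyclicPacking k T) :
    G.adjPairs S S < 2 * (2 * (k : ℝ) - 1) * #S + 12 * (k : ℝ) ^ 2 := by
  by_contra! hc
  exact h ((CyclicPacking.of_adjPairs hk hc).mono hST)

/-- A graph without `k` disjoint cycles is `6k`-degenerate. -/
lemma exists_degIn_lt_of_not_cyclicPacking {k : ℕ} (hk : 1 ≤ k) {S T : Finset V} (hST : S ⊆ T)
    (h : ¬ G.CyclicPacking k T) (hS : S.Nonempty) : ∃ v ∈ S, G.degIn S v < 6 * (k : ℝ) := by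
  by_contra! hc
  have h1 := adjPairs_self_lt_of_not_cyclicPacking hk hST h
  have h2 := card_nsmul_le_sum S (G.degIn S) _ hc
  rw [nsmul_eq_mul] at h2
  change _ ≤ G.adjPairs S S at h2
  have hk1 : (1 : ℝ) ≤ k := by exact_mod_cast hk
  obtain ⟨v, hv⟩ := hS
  -- Minimum degree `6k` forces `#S ≥ 6k`, which lets the linear term absorb `12k²`.
  have h3 := (hc v hv).trans (G.degIn_le_card S v)
  nlinarith

/-- Many common neighbours of `2j` vertices give `j` disjoint quadrilaterals. -/
lemma CyclicPacking.of_common_neighbors {j : ℕ} {L Z : Finset V} (hL : 2 * j ≤ #L)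
    (hZ : 2 * j ≤ #Z) (hadj : ∀ a ∈ L, ∀ z ∈ Z, G.Adj a z) : G.CyclicPacking j (L ∪ Z) := by
  induction j generalizing L Z with
  | zero => trivial
  | succ j ih =>
    obtain ⟨a, ha, b, hb, hab⟩ := one_lt_card.1 (show 1 < #L by omega)
    obtain ⟨p, hp, q, hq, hpq⟩ := one_lt_card.1 (show 1 < #Z by omega)
    have hLc : 2 * j ≤ #(L \ {a, b}) := by
      have := le_card_sdiff {a, b} L
      rw [card_pair hab] at this
      omega
    have hZc : 2 * j ≤ #(Z \ {p, q}) := by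
      have := le_card_sdiff {p, q} Z
      rw [card_pair hpq] at this
      omega
    refine (ih hLc hZc fun a ha z hz => hadj a (mem_sdiff.1 ha).1 z
      (mem_sdiff.1 hz).1).succ_of_disjoint (isCyclicSet_square hab hpq (hadj _ ha _ hp)
      (hadj _ ha _ hq) (hadj _ hb _ hp) (hadj _ hb _ hq)) ?_ ?_ ?_
    · exact union_subset_union sdiff_subset sdiff_subset
    · intro x
      simp only [mem_insert, mem_singleton, mem_union]
      rintro (rfl | rfl | rfl | rfl) <;> simp [*]
    · refine Finset.disjoint_left.2 fun x hx hx' => ?_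
      simp only [mem_insert, mem_singleton, mem_union, mem_sdiff, not_or] at hx hx'
      rcases hx' with ⟨h1, h2, h3⟩ | ⟨h1, h2, h3⟩
      · rcases hx with rfl | rfl | rfl | rfl
        · exact h2 rfl
        · exact h3 rfl
        · exact G.loopless.irrefl _ (hadj _ h1 _ hp)
        · exact G.loopless.irrefl _ (hadj _ h1 _ hq)
      · rcases hx with rfl | rfl | rfl | rfl
        · exact G.loopless.irrefl _ (hadj _ ha _ h1)
        · exact G.loopless.irrefl _ (hadj _ hb _ h1)
        · exact h2 rfl
        · exact h3 rfl

/-- A forest extends to a maximal one in the complete graph, which is a spanning tree. -/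
lemma IsAcyclic.card_edgeFinset_lt [Fintype V] [Nonempty V] (h : G.IsAcyclic) :
    #G.edgeFinset < Fintype.card V := by
  obtain ⟨F, hGF, hF⟩ := exists_maximal_isAcyclic_of_le_isAcyclic (le_top : G ≤ ⊤) h
  have hT := (connected_top.maximal_le_isAcyclic_iff_isTree le_top).1 hF
  have h1 := hT.card_edgeFinset
  have h2 : #G.edgeFinset ≤ #F.edgeFinset := card_le_card (edgeFinset_mono hGF)
  omega

lemma IsCyclicSet.not_isAcyclic_induce {W : Finset V} (h : G.IsCyclicSet W) :
    ¬ (G.induce (W : Set V)).IsAcyclic := by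
  intro hac
  have : Nonempty (W : Set V) := h.1.to_subtype
  have h1 : #(G.induce (W : Set V)).edgeFinset < #W := by
    convert hac.card_edgeFinset_lt
    simp
  have h2 := (G.induce (W : Set V)).sum_degrees_eq_twice_card_edges
  have h3 : G.adjPairs W W = ∑ v : (W : Set V), ((G.induce (W : Set V)).degree v : ℝ) := by
    rw [adjPairs, ← sum_coe_sort]
    refine sum_congr rfl fun v _ => ?_
    rw [degIn_eq_card, ← card_neighborFinset_eq_degree]
    norm_cast
    symm
    refine card_bij (fun (w : (W : Set V)) _ => (w : V)) ?_ ?_ ?_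
    · intro w hw
      rw [mem_neighborFinset] at hw
      exact mem_filter.2 ⟨w.2, hw⟩
    · intro w _ w' _ hww
      exact Subtype.ext hww
    · intro w hw
      rw [mem_filter] at hw
      exact ⟨⟨w, hw.1⟩, by rw [mem_neighborFinset]; exact hw.2, rfl⟩
  have h5 := h.2
  rw [h3, ← Nat.cast_sum, h2] at h5
  have : 2 * #W ≤ 2 * #(G.induce (W : Set V)).edgeFinset := by exact_mod_cast h5
  omega

lemma IsCyclicSet.exists_isCycle {W : Finset V} (h : G.IsCyclicSet W) :
    ∃ (v : V) (c : G.Walk v v), c.IsCycle ∧ ∀ x ∈ c.support, x ∈ W := by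
  have := h.not_isAcyclic_induce
  rw [IsAcyclic] at this
  push Not at this
  obtain ⟨v, c, hc⟩ := this
  refine ⟨_, c.map (Embedding.induce (W : Set V)).toHom, hc.map Subtype.val_injective, ?_⟩
  intro x hx
  rw [Walk.support_map, List.mem_map] at hx
  obtain ⟨y, -, rfl⟩ := hx
  exact y.2

lemma CyclicPacking.exists_cycles {k : ℕ} {S : Finset V} (h : G.CyclicPacking k S) :
    ∃ (v : Fin k → V) (c : ∀ i, G.Walk (v i) (v i)), (∀ i, (c i).IsCycle) ∧
      (∀ i, ∀ x ∈ (c i).support, x ∈ S) ∧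
      ∀ i j, i ≠ j → List.Disjoint (c i).support (c j).support := by
  induction k generalizing S with
  | zero => exact ⟨Fin.elim0, fun i => i.elim0, fun i => i.elim0, fun i => i.elim0,
      fun i => i.elim0⟩
  | succ k ih =>
    obtain ⟨W, hWS, hW, hp⟩ := h
    obtain ⟨v, c, hc, hs, hd⟩ := ih hp
    obtain ⟨v₀, c₀, hc₀, hs₀⟩ := hW.exists_isCycle
    refine ⟨Fin.cons v₀ v, Fin.cons (α := fun i => G.Walk ((Fin.cons v₀ v : Fin (k + 1) → V) i)
      ((Fin.cons v₀ v : Fin (k + 1) → V) i)) c₀ c, ?_, ?_, ?_⟩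
    · intro i
      refine Fin.cases ?_ (fun i => ?_) i
      · exact hc₀
      · exact hc i
    · intro i
      refine Fin.cases ?_ (fun i => ?_) i
      · exact fun x hx => hWS (hs₀ x hx)
      · exact fun x hx => (mem_sdiff.1 (hs i x hx)).1
    · intro i j
      refine Fin.cases ?_ (fun i => ?_) i <;> refine Fin.cases ?_ (fun j => ?_) j
      · exact fun h => absurd rfl h
      · exact fun _ x hx hx' => (mem_sdiff.1 (hs j x hx')).2 (hs₀ x hx)
      · exact fun _ x hx hx' => (mem_sdiff.1 (hs i x hx)).2 (hs₀ x hx')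
      · exact fun hij => hd i j fun h => hij (by rw [h])

lemma CyclicPacking.hasIndependentCycles {k : ℕ} {S : Finset V} (h : G.CyclicPacking k S) :
    G.HasIndependentCycles k := by
  obtain ⟨v, c, hc, -, hd⟩ := h.exists_cycles
  exact ⟨v, c, hc, hd⟩

end SimpleGraph

/-! ### Spectral radius, Rayleigh quotients and split graphs -/

namespace SimpleGraph

open Finset Matrix
open scoped Classical

variable {V : Type*} [Fintype V]

/-- The quadratic form of the adjacency matrix of `G`. -/
noncomputable def adjForm (G : SimpleGraph V) (x : V → ℝ) : ℝ :=
  ∑ u, ∑ v, G.adjInd u v * (x u * x v)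

variable (G : SimpleGraph V)

lemma adjMatrix_mulVec_eq (x : V → ℝ) (v : V) :
    (G.adjMatrix ℝ *ᵥ x) v = ∑ w, G.adjInd v w * x w := by
  simp [mulVec, dotProduct, adjMatrix_apply, adjInd]

lemma adjForm_eq_dotProduct (x : V → ℝ) : G.adjForm x = x ⬝ᵥ (G.adjMatrix ℝ *ᵥ x) := by
  simp only [adjForm, dotProduct, adjMatrix_mulVec_eq, mul_sum]
  exact sum_congr rfl fun _ _ => sum_congr rfl fun _ _ => by ring

/-- The spectral radius of a graph is the maximum of the Rayleigh quotient of its adjacency matrix,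
and it is attained at a nonnegative eigenvector. -/
theorem exists_adjSpectralRadius_eq [Nonempty V] : ∃ r : ℝ, 0 ≤ r ∧
    G.adjSpectralRadius = ENNReal.ofReal r ∧ (∀ z, G.adjForm z ≤ r * ∑ v, z v ^ 2) ∧
    (∀ z, G.adjForm z = r * ∑ v, z v ^ 2 → ∀ v, ∑ w, G.adjInd v w * z w = r * z v) ∧
    ∃ x : V → ℝ, (∀ v, 0 ≤ x v) ∧ x ≠ 0 ∧ ∀ v, ∑ w, G.adjInd v w * x w = r * x v := by
  have hA := G.isHermitian_adjMatrix ℝ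
  obtain ⟨i, -, hi⟩ := exists_max_image (univ : Finset V) (fun i => |hA.eigenvalues i|)
    univ_nonempty
  set r := |hA.eigenvalues i| with hr
  have hsq : ∀ z : V → ℝ, z ⬝ᵥ z = ∑ v, z v ^ 2 := fun z => by simp [dotProduct, sq]
  have hspec : G.adjSpectralRadius = ENNReal.ofReal r := by
    rw [adjSpectralRadius, spectralRadius, hA.spectrum_real_eq_range_eigenvalues]
    have hn : ∀ t : ℝ, (‖t‖₊ : ENNReal) = ENNReal.ofReal |t| := fun t => by
      rw [← Real.norm_eq_abs, ofReal_norm, enorm_eq_nnnorm]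
    refine le_antisymm (iSup₂_le ?_) ?_
    · rintro _ ⟨j, rfl⟩
      rw [hn]
      exact ENNReal.ofReal_le_ofReal (hi j (mem_univ _))
    · rw [hr, ← hn]
      exact le_iSup₂_of_le (hA.eigenvalues i) ⟨i, rfl⟩ le_rfl
  have hmul : ∀ z : V → ℝ, (algebraMap ℝ (Matrix V V ℝ) r - G.adjMatrix ℝ) *ᵥ z =
      r • z - G.adjMatrix ℝ *ᵥ z := fun z => by
    rw [sub_mulVec, Algebra.algebraMap_eq_smul_one, smul_mulVec, one_mulVec]
  have hB : (algebraMap ℝ (Matrix V V ℝ) r - G.adjMatrix ℝ).IsHermitian := by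
    refine IsHermitian.sub ?_ hA
    rw [Algebra.algebraMap_eq_smul_one, Matrix.IsHermitian, conjTranspose_smul, conjTranspose_one]
    simp
  -- The eigenvalues of `r - A` are `r - λ ≥ 0`. Semidefiniteness gives the Rayleigh bound, and
  -- vectors where the form vanishes lie in the kernel.
  have hpsd : (algebraMap ℝ (Matrix V V ℝ) r - G.adjMatrix ℝ).PosSemidef := by
    rw [hB.posSemidef_iff_eigenvalues_nonneg]
    intro j
    have hm := hB.eigenvalues_mem_spectrum_real j
    rw [← spectrum.singleton_sub_eq, hA.spectrum_real_eq_range_eigenvalues] at hm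
    obtain ⟨_, rfl, _, ⟨l, rfl⟩, hl⟩ := hm
    rw [Pi.zero_apply, ← hl]
    have := (le_abs_self _).trans (hi l (mem_univ _))
    exact sub_nonneg.2 this
  have hform : ∀ z : V → ℝ, z ⬝ᵥ ((algebraMap ℝ (Matrix V V ℝ) r - G.adjMatrix ℝ) *ᵥ z) =
      r * ∑ v, z v ^ 2 - G.adjForm z := fun z => by
    rw [hmul, dotProduct_sub, dotProduct_smul, hsq, adjForm_eq_dotProduct, smul_eq_mul]
  have hle : ∀ z, G.adjForm z ≤ r * ∑ v, z v ^ 2 := fun z => by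
    have := hpsd.dotProduct_mulVec_nonneg z
    rw [star_trivial, hform] at this
    linarith
  have heq : ∀ z, G.adjForm z = r * ∑ v, z v ^ 2 → ∀ v, ∑ w, G.adjInd v w * z w = r * z v := by
    intro z hz v
    have := (hpsd.dotProduct_mulVec_zero_iff z).1 (by rw [star_trivial, hform]; linarith)
    rw [hmul] at this
    have := congrFun this v
    rw [Pi.sub_apply, adjMatrix_mulVec_eq, Pi.smul_apply, smul_eq_mul, Pi.zero_apply] at this
    linarith
  refine ⟨r, abs_nonneg _, hspec, hle, heq, ?_⟩
  let y : V → ℝ := hA.eigenvectorBasis i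
  have hy : G.adjMatrix ℝ *ᵥ y = hA.eigenvalues i • y := hA.mulVec_eigenvectorBasis i
  have hy0 : y ≠ 0 := fun h => by
    have := hA.eigenvectorBasis.orthonormal.ne_zero i
    exact this (by ext v; exact congrFun h v)
  -- Perron's argument: passing to absolute values keeps the norm and does not lower the absolute
  -- value of the form, so `|y|` attains the Rayleigh maximum, even when the extremal eigenvalue is
  -- `-r`.
  refine ⟨fun v => |y v|, fun v => abs_nonneg _, fun h => hy0 ?_, heq _ ?_⟩
  · ext v
    simpa using congrFun h v
  · refine le_antisymm (hle _) ?_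
    have h1 : G.adjForm y = hA.eigenvalues i * ∑ v, y v ^ 2 := by
      rw [adjForm_eq_dotProduct, hy, dotProduct_smul, hsq, smul_eq_mul]
    have h2 : |G.adjForm y| = r * ∑ v, |y v| ^ 2 := by
      rw [h1, abs_mul, ← hr, abs_of_nonneg (sum_nonneg fun v _ => sq_nonneg (y v))]
      simp
    rw [← h2]
    refine (abs_sum_le_sum_abs _ _).trans (sum_le_sum fun u _ =>
      (abs_sum_le_sum_abs _ _).trans (sum_le_sum fun v _ => ?_))
    rw [abs_mul, abs_mul, abs_of_nonneg (G.adjInd_nonneg u v)]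

variable {G}

lemma Iso.adjSpectralRadius_eq {W : Type*} [Fintype W] {H : SimpleGraph W} (f : G ≃g H) :
    G.adjSpectralRadius = H.adjSpectralRadius := by
  have h : spectrum ℝ (G.adjMatrix ℝ) = spectrum ℝ (H.adjMatrix ℝ) := by
    rw [← f.reindex_adjMatrix ℝ]
    exact (AlgEquiv.spectrum_eq (reindexAlgEquiv ℝ ℝ f.toEquiv) _).symm
  simp only [adjSpectralRadius, spectralRadius, h]

/-- The join of a clique on `L` with an independent set on the complement of `L`. -/
def splitOn (L : Finset V) : SimpleGraph V where
  Adj u v := u ≠ v ∧ (u ∈ L ∨ v ∈ L)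
  symm := ⟨fun _ _ h => ⟨h.1.symm, h.2.symm⟩⟩
  loopless := ⟨fun _ h => h.1 rfl⟩

lemma nonempty_splitOn_iso {n s : ℕ} (hV : Fintype.card V = n) (L : Finset V) (hL : #L = s) :
    Nonempty (splitOn L ≃g completeSplitGraph n s) := by
  have hs : s ≤ n := hL ▸ hV ▸ card_le_univ L
  let e : V ≃ Fin n := Fintype.equivFinOfCardEq hV
  have hc : Fintype.card {v : V // v ∈ L} = Fintype.card {i : Fin n // i.val < s} := by
    rw [Fintype.card_coe, hL, Fintype.card_subtype]
    have := Fin.card_filter_val_lt (n := n) (m := s)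
    rw [this, min_eq_right hs]
  let e' : {v : V // v ∈ L} ≃ {i : Fin n // i.val < s} := Fintype.equivOfCardEq hc
  have hc' : Fintype.card {v : V // ¬ v ∈ L} = Fintype.card {i : Fin n // ¬ i.val < s} := by
    rw [Fintype.card_subtype_compl, Fintype.card_subtype_compl, hc, hV, Fintype.card_fin]
  let f : V ≃ Fin n := (Equiv.sumCompl (· ∈ L)).symm.trans
    ((e'.sumCongr (Fintype.equivOfCardEq hc')).trans (Equiv.sumCompl fun i : Fin n => i.val < s))
  have hf : ∀ v, (f v).val < s ↔ v ∈ L := by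
    intro v
    by_cases hv : v ∈ L
    · simp only [hv, iff_true]
      have : f v = e' ⟨v, hv⟩ := by simp [f, Equiv.sumCompl_symm_apply_of_pos hv]
      rw [this]
      exact (e' ⟨v, hv⟩).2
    · simp only [hv, iff_false]
      have : f v = Fintype.equivOfCardEq hc' ⟨v, hv⟩ := by
        simp [f, Equiv.sumCompl_symm_apply_of_neg hv]
      rw [this]
      exact (Fintype.equivOfCardEq hc' ⟨v, hv⟩).2
  exact ⟨⟨f, fun {a b} => by simp [completeSplitGraph, splitOn, hf]⟩⟩

/-- Only pairs between `L` and its complement are counted; pairs inside `L` contribute `a² ≥ 0`.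
This is used to bound the spectral radius of the split graph from below by that of its complete
bipartite subgraph. -/
lemma sum_sq_mul_le_adjForm_splitOn {L : Finset V} (a b : ℝ) :
    2 * (#L : ℝ) * #Lᶜ * (a * b) ≤ (splitOn L).adjForm fun v => if v ∈ L then a else b := by
  have h : ∀ u v, (if u ∈ L ∧ v ∈ Lᶜ then a * b else 0) + (if u ∈ Lᶜ ∧ v ∈ L then a * b else 0) ≤
      (splitOn L).adjInd u v * ((if u ∈ L then a else b) * (if v ∈ L then a else b)) := by
    intro u v
    by_cases hu : u ∈ L <;> by_cases hv : v ∈ L <;> simp only [hu, hv, adjInd, splitOn, mem_compl]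
    · have := mul_self_nonneg a
      simp; split_ifs <;> simp [this]
    · have : u ≠ v := fun h => hv (h ▸ hu)
      simp [this]
    · have : u ≠ v := fun h => hu (h ▸ hv)
      simp [this, mul_comm]
    · simp
  refine le_trans (le_of_eq ?_) (sum_le_sum fun u _ => sum_le_sum fun v _ => h u v)
  have e1 : ∀ u, (∑ v, if u ∈ L ∧ v ∈ Lᶜ then a * b else 0) =
      if u ∈ L then #Lᶜ * (a * b) else 0 := by
    intro u
    by_cases hu : u ∈ L
    · simp only [hu, true_and, ← sum_filter, filter_mem_eq_inter, univ_inter, sum_const,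
        nsmul_eq_mul, if_true]
    · simp [hu]
  have e2 : ∀ u, (∑ v, if u ∈ Lᶜ ∧ v ∈ L then a * b else 0) =
      if u ∈ Lᶜ then #L * (a * b) else 0 := by
    intro u
    by_cases hu : u ∈ L <;> simp [hu]
  simp only [sum_add_distrib, e1, e2, ← sum_filter, filter_mem_eq_inter, sum_const, univ_inter,
    nsmul_eq_mul]
  ring

end SimpleGraph

/-! ### The eigenvector and the total weight of its heavy entries -/

namespace SimpleGraph

open Finset
open scoped Classical

variable {V : Type*} {G : SimpleGraph V}

/-- The number of common neighbours of `u` and `w` in `R`, as a real number. -/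
noncomputable def codegIn (G : SimpleGraph V) (R : Finset V) (u w : V) : ℝ :=
  ∑ v ∈ R, G.adjInd u v * G.adjInd v w

lemma sum_mul_degIn_eq (x : V → ℝ) (S T : Finset V) :
    ∑ u ∈ S, ∑ v ∈ T, G.adjInd u v * x v = ∑ v ∈ T, G.degIn S v * x v := by
  rw [sum_comm]
  refine sum_congr rfl fun v _ => ?_
  rw [degIn, sum_mul]
  exact sum_congr rfl fun u _ => by rw [adjInd_comm]

lemma sum_codegIn_mul (R A : Finset V) (u : V) (x : V → ℝ) :
    ∑ w ∈ A, G.codegIn R u w * x w =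
      ∑ v ∈ R, G.adjInd u v * ∑ w ∈ A, G.adjInd v w * x w := by
  simp only [codegIn, sum_mul, mul_sum]
  rw [sum_comm]
  exact sum_congr rfl fun _ _ => sum_congr rfl fun _ _ => by ring

lemma sum_codegIn (R A : Finset V) (u : V) :
    ∑ w ∈ A, G.codegIn R u w = G.adjPairs {v ∈ R | G.Adj u v} A := by
  have := sum_codegIn_mul (G := G) R A u 1
  simp only [Pi.one_apply, mul_one] at this
  rw [this, adjPairs, sum_filter]
  refine sum_congr rfl fun v _ => ?_
  by_cases h : G.Adj u v <;> simp [h, adjInd, degIn]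

lemma codegIn_nonneg (R : Finset V) (u w : V) : 0 ≤ G.codegIn R u w :=
  sum_nonneg fun _ _ => mul_nonneg (G.adjInd_nonneg _ _) (G.adjInd_nonneg _ _)

lemma codegIn_le_card (R : Finset V) (u w : V) : G.codegIn R u w ≤ #R := by
  simpa [codegIn] using sum_le_card_nsmul R (fun v => G.adjInd u v * G.adjInd v w) 1 fun v _ =>
    mul_le_one₀ (G.adjInd_le_one _ _) (G.adjInd_nonneg _ _) (G.adjInd_le_one _ _)

lemma degIn_add_degIn_sub_card_le_codegIn (R : Finset V) (u w : V) :
    G.degIn R u + G.degIn R w - #R ≤ G.codegIn R u w := by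
  rw [degIn, degIn, codegIn, card_eq_sum_ones]
  push_cast
  rw [← sum_add_distrib, ← sum_sub_distrib]
  refine sum_le_sum fun v _ => ?_
  rw [G.adjInd_comm w v]
  nlinarith [G.adjInd_le_one u v, G.adjInd_le_one v w]

variable [Fintype V]

/-- A nonnegative eigenvector with largest entry `1`, for a large eigenvalue of a large graph
without `k` disjoint cycles. -/
structure IsLargeEigenpair (G : SimpleGraph V) (k : ℕ) (r : ℝ) (x : V → ℝ) : Prop where
  one_le : 1 ≤ k
  le_card : 230400 * (2 * (k : ℝ) - 1) * (k : ℝ) ^ 4 ≤ Fintype.card V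
  nonneg : 0 ≤ r
  le_sq : (2 * (k : ℝ) - 1) * (Fintype.card V - (2 * (k : ℝ) - 1)) ≤ r ^ 2
  entry_nonneg : ∀ v, 0 ≤ x v
  entry_le_one : ∀ v, x v ≤ 1
  eigen : ∀ v, ∑ w, G.adjInd v w * x w = r * x v
  exists_entry_eq_one : ∃ u, x u = 1
  not_packing : ¬ G.CyclicPacking k univ

/-- The vertices at which `x` is at least `1 / (16 k)`. -/
noncomputable def heavySet (k : ℕ) (x : V → ℝ) : Finset V := {v | 1 ≤ 16 * (k : ℝ) * x v}

lemma card_heavySet_le (k : ℕ) (x : V → ℝ) :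
    (#(heavySet k x) : ℝ) ≤ 16 * k * ∑ v ∈ heavySet k x, x v := by
  rw [mul_sum, card_eq_sum_ones]
  push_cast
  exact sum_le_sum fun v hv => (mem_filter.1 hv).2

lemma card_heavySet_add_card_compl (k : ℕ) (x : V → ℝ) :
    (#(heavySet k x) : ℝ) + #(heavySet k x)ᶜ = Fintype.card V := by
  exact_mod_cast card_add_card_compl _

/-- The numerical part of the bound on the sum of the heavy entries. -/
lemma le_of_mul_sq_le {k s n r T a : ℝ} (hk : 1 ≤ k) (hs : s = 2 * k - 1)
    (hn : 230400 * s * k ^ 4 ≤ n) (hrn : 330 * k ^ 2 * r ≤ n) (hr : 0 ≤ r) (hT : 0 ≤ T)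
    (ha : a ≤ 16 * k * T) (hsq : s * (n - s) ≤ r ^ 2)
    (h : r ^ 2 * T ≤ r * (2 * s * a + 12 * k ^ 2) +
      (s * (s * n + 6 * k ^ 2) + r * (1 / 16 * (s * a + 6 * k ^ 2)))) :
    T ≤ 5 / 4 * s := by
  have hs1 : 1 ≤ s := by linarith
  have hs0 : 0 ≤ s := by linarith
  have hk0 : 0 ≤ k := by linarith
  have hk24 : k ^ 2 ≤ k ^ 4 := pow_le_pow_right₀ hk (by norm_num)
  have hk4 : 1 ≤ k ^ 4 := one_le_pow₀ hk
  have c1 : s * k ^ 2 ≤ n / 230400 := by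
    have := mul_le_mul_of_nonneg_left hk24 hs0
    linarith
  have c2 : s ≤ n / 230400 := by
    have := mul_le_mul_of_nonneg_left hk4 hs0
    linarith
  have hn0 : 0 < n := by linarith
  have hsT : 0 ≤ s * T := mul_nonneg hs0 hT
  have hra : r * (s * a) ≤ 16 / 330 * (s * n * T) := by
    have h1 : r * (s * a) ≤ r * (s * (16 * k * T)) := by gcongr
    have h2 : k ≤ k ^ 2 := by nlinarith
    have h3 : k * r ≤ k ^ 2 * r := mul_le_mul_of_nonneg_right h2 hr
    have h4 : k * r * (s * T) ≤ n / 330 * (s * T) :=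
      mul_le_mul_of_nonneg_right (by linarith) hsT
    linarith
  have hrk : r * k ^ 2 ≤ n / 330 := by linarith
  have hsqT : (s * (n - s)) * T ≤ r ^ 2 * T := mul_le_mul_of_nonneg_right hsq hT
  have m1 : s * T * s ≤ s * T * (n / 230400) := mul_le_mul_of_nonneg_left c2 hsT
  have m2 : n ≤ s * n * s := by
    have : 1 * 1 ≤ s * s := mul_le_mul hs1 hs1 zero_le_one hs0
    have := mul_le_mul_of_nonneg_left this hn0.le
    linarith
  by_contra! hlt
  have m3 : s * n * (5 / 4 * s) < s * n * T :=
    mul_lt_mul_of_pos_left hlt (mul_pos (by linarith) hn0)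
  linarith

namespace IsLargeEigenpair

variable {k : ℕ} {r : ℝ} {x : V → ℝ}

lemma one_le_cast (h : G.IsLargeEigenpair k r x) : (1 : ℝ) ≤ k := by exact_mod_cast h.one_le

lemma adjPairs_self_le (h : G.IsLargeEigenpair k r x) (S : Finset V) :
    G.adjPairs S S ≤ 2 * (2 * (k : ℝ) - 1) * #S + 12 * (k : ℝ) ^ 2 :=
  (adjPairs_self_lt_of_not_cyclicPacking h.one_le (subset_univ S) h.not_packing).le

lemma adjPairs_le (h : G.IsLargeEigenpair k r x) {S T : Finset V} (hd : Disjoint S T) :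
    G.adjPairs S T + G.adjPairs S S / 2 + G.adjPairs T T / 2 ≤
      (2 * (k : ℝ) - 1) * (#S + #T) + 6 * (k : ℝ) ^ 2 := by
  have h1 := h.adjPairs_self_le (S ∪ T)
  rw [adjPairs_union_self G hd, card_union_of_disjoint hd] at h1
  push_cast at h1
  linarith

lemma entry_lt (h : G.IsLargeEigenpair k r x) {v : V} (hv : v ∉ heavySet k x) :
    x v ≤ 1 / (16 * k) := by
  have hk := h.one_le_cast
  rw [heavySet, mem_filter] at hv
  push Not at hv
  rw [le_div_iff₀ (by positivity)]
  linarith [hv (mem_univ v)]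

lemma sum_split (h : G.IsLargeEigenpair k r x) (v : V) :
    r * x v = ∑ w ∈ heavySet k x, G.adjInd v w * x w +
      ∑ w ∈ (heavySet k x)ᶜ, G.adjInd v w * x w := by
  rw [← h.eigen v, sum_add_sum_compl]

lemma sum_adjInd_mul_le_degIn (h : G.IsLargeEigenpair k r x) (S : Finset V) (v : V) :
    ∑ w ∈ S, G.adjInd v w * x w ≤ G.degIn S v :=
  sum_le_sum fun w _ => mul_le_of_le_one_right (G.adjInd_nonneg _ _) (h.entry_le_one w)

lemma sum_compl_heavySet_le (h : G.IsLargeEigenpair k r x) (v : V) :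
    ∑ w ∈ (heavySet k x)ᶜ, G.adjInd v w * x w ≤ 1 / (16 * k) * G.degIn (heavySet k x)ᶜ v := by
  rw [degIn, mul_sum]
  refine sum_le_sum fun w hw => ?_
  rw [mul_comm]
  exact mul_le_mul_of_nonneg_right (h.entry_lt (mem_compl.1 hw)) (G.adjInd_nonneg _ _)

lemma light_coeff_le (h : G.IsLargeEigenpair k r x) : 1 / (16 * (k : ℝ)) ≤ 1 / 16 := by
  have hk := h.one_le_cast
  exact one_div_le_one_div_of_le (by norm_num) (by linarith)

/-- At a vertex with entry `1`, `r²` is at most the number of two-step walks from it, hence at most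
the sum of all degrees. -/
lemma sq_le (h : G.IsLargeEigenpair k r x) :
    r ^ 2 ≤ 2 * (2 * (k : ℝ) - 1) * Fintype.card V + 12 * (k : ℝ) ^ 2 := by
  obtain ⟨u, hu⟩ := h.exists_entry_eq_one
  have h1 : r ^ 2 = ∑ v, G.adjInd u v * (r * x v) := by
    have := h.eigen u
    rw [hu, mul_one] at this
    rw [sq]
    nth_rewrite 2 [← this]
    rw [mul_sum]
    exact sum_congr rfl fun _ _ => by ring
  rw [h1]
  refine le_trans ?_ (h.adjPairs_self_le univ)
  refine sum_le_sum fun v _ => ?_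
  rw [← h.eigen v]
  exact (mul_le_of_le_one_left (sum_nonneg fun w _ => mul_nonneg (G.adjInd_nonneg _ _)
    (h.entry_nonneg w)) (G.adjInd_le_one _ _)).trans (h.sum_adjInd_mul_le_degIn _ _)

/-- By `sq_le`, `r` is of order `√(kn)`, so terms of size `k² r` are negligible against `n`. The
constant works because `2 · 330² < 230400`, with room for the `12k²` term. -/
lemma mul_le_card (h : G.IsLargeEigenpair k r x) : 330 * (k : ℝ) ^ 2 * r ≤ Fintype.card V := by
  have hk := h.one_le_cast
  have h1 := h.sq_le
  have h2 := h.le_card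
  set n : ℝ := (Fintype.card V : ℝ)
  have hk4 : (1 : ℝ) ≤ (k : ℝ) ^ 4 := one_le_pow₀ hk
  have hn : (0 : ℝ) ≤ n := Nat.cast_nonneg _
  have h3 : 230400 * (k : ℝ) ^ 4 ≤ n := by nlinarith
  have hk2 : (k : ℝ) ^ 2 ≤ k ^ 4 := pow_le_pow_right₀ hk (by norm_num)
  refine le_of_sq_le_sq ?_ hn
  have h4 : (330 * (k : ℝ) ^ 2 * r) ^ 2 ≤
      108900 * k ^ 4 * (2 * (2 * (k : ℝ) - 1) * n + 12 * (k : ℝ) ^ 2) := by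
    have : (330 * (k : ℝ) ^ 2 * r) ^ 2 = 108900 * k ^ 4 * r ^ 2 := by ring
    rw [this]
    exact mul_le_mul_of_nonneg_left h1 (by positivity)
  have h5 : 217800 * (2 * (k : ℝ) - 1) * k ^ 4 * n ≤ 217800 / 230400 * n * n := by nlinarith
  have h6 : (k : ℝ) ^ 4 * k ^ 2 ≤ k ^ 4 * k ^ 4 := mul_le_mul_of_nonneg_left hk2 (by positivity)
  have h7 : 230400 * (k : ℝ) ^ 4 * (230400 * (k : ℝ) ^ 4) ≤ n * n :=
    mul_le_mul h3 h3 (by positivity) hn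
  nlinarith

/-- The eigenvalue equation is summed over the heavy set and then applied again to the light
entries, giving `r² T ≤ s² n` up to small terms, where `T` is the heavy weight. With `r² ≥ s(n - s)`
this puts `T` near `s` at most, and `#A ≤ 16kT` bounds the size of the heavy set. -/
lemma sum_heavySet_le (h : G.IsLargeEigenpair k r x) :
    ∑ v ∈ heavySet k x, x v ≤ 5 / 4 * (2 * (k : ℝ) - 1) := by
  have hk := h.one_le_cast
  have hr := h.nonneg
  have hA := card_heavySet_le k x
  have hcoef := h.light_coeff_le
  have hcard := card_heavySet_add_card_compl k x
  have hdis : Disjoint (heavySet k x)ᶜ (heavySet k x) := disjoint_compl_left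
  have hlight : ∀ v ∈ (heavySet k x)ᶜ, x v ≤ 1 / (16 * k) := fun v hv =>
    h.entry_lt (mem_compl.1 hv)
  set A := heavySet k x with hAdef
  set T := ∑ v ∈ A, x v with hT
  set s : ℝ := 2 * (k : ℝ) - 1 with hs
  have hs1 : 1 ≤ s := by linarith
  have hT0 : 0 ≤ T := sum_nonneg fun v _ => h.entry_nonneg v
  have hη : (0 : ℝ) ≤ 1 / (16 * k) := by positivity
  have e1 : r * T = ∑ u ∈ A, ∑ v ∈ A, G.adjInd u v * x v + ∑ v ∈ Aᶜ, G.degIn A v * x v := by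
    rw [hT, mul_sum, ← sum_mul_degIn_eq, ← sum_add_distrib]
    exact sum_congr rfl fun u _ => h.sum_split u
  have e2 : ∑ u ∈ A, ∑ v ∈ A, G.adjInd u v * x v ≤ 2 * s * #A + 12 * (k : ℝ) ^ 2 :=
    (sum_le_sum fun u _ => h.sum_adjInd_mul_le_degIn A u).trans (h.adjPairs_self_le A)
  have e3 : ∑ v ∈ Aᶜ, G.degIn A v * x v ≤
      s * ∑ v ∈ Aᶜ, x v + 1 / (16 * k) * (s * #A + 6 * (k : ℝ) ^ 2) := by
    -- The edge bound on `Y ∪ A` limits the total excess of heavy degrees over `s`, and the excess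
    -- is weighted only by light entries.
    let Y := Aᶜ.filter fun v => s < G.degIn A v
    have hY : ∑ v ∈ Y, (G.degIn A v - s) ≤ s * #A + 6 * (k : ℝ) ^ 2 := by
      rw [sum_sub_distrib, sum_const, nsmul_eq_mul]
      have := h.adjPairs_le (hdis.mono_left (filter_subset (fun v => s < G.degIn A v) _))
      have p1 := G.adjPairs_nonneg Y Y
      have p2 := G.adjPairs_nonneg A A
      change G.adjPairs Y A - _ ≤ _
      change G.adjPairs Y A + G.adjPairs Y Y / 2 + _ ≤ s * (#Y + #A) + _ at this
      linarith
    have : ∀ v ∈ Aᶜ, G.degIn A v * x v ≤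
        s * x v + 1 / (16 * k) * (if s < G.degIn A v then G.degIn A v - s else 0) := by
      intro v hv
      have hxv := hlight v hv
      have hx0 := h.entry_nonneg v
      split_ifs with hlt
      · nlinarith
      · rw [mul_zero, add_zero]
        exact mul_le_mul_of_nonneg_right (not_lt.1 hlt) hx0
    refine (sum_le_sum this).trans ?_
    rw [sum_add_distrib, ← mul_sum, ← mul_sum, ← sum_filter]
    have := mul_le_mul_of_nonneg_left hY hη
    linarith
  have e4 : r * ∑ v ∈ Aᶜ, x v ≤ s * Fintype.card V + 6 * (k : ℝ) ^ 2 := by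
    have : r * ∑ v ∈ Aᶜ, x v ≤ G.adjPairs Aᶜ A + 1 / (16 * k) * G.adjPairs Aᶜ Aᶜ := by
      rw [adjPairs, adjPairs, mul_sum, mul_sum, ← sum_add_distrib]
      refine sum_le_sum fun v _ => ?_
      rw [h.sum_split v]
      exact add_le_add (h.sum_adjInd_mul_le_degIn _ v) (h.sum_compl_heavySet_le v)
    have p1 := h.adjPairs_le hdis
    have p2 := G.adjPairs_nonneg A A
    have p3 := G.adjPairs_nonneg Aᶜ Aᶜ
    rw [← hcard]
    nlinarith
  have hrT : r ^ 2 * T ≤ r * (2 * s * #A + 12 * (k : ℝ) ^ 2) +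
      (s * (s * Fintype.card V + 6 * (k : ℝ) ^ 2) + r * (1 / 16 * (s * #A + 6 * (k : ℝ) ^ 2))) := by
    have q1 : r ^ 2 * T = r * (r * T) := by ring
    have q2 : 1 / (16 * (k : ℝ)) * (s * #A + 6 * (k : ℝ) ^ 2) ≤
        1 / 16 * (s * #A + 6 * (k : ℝ) ^ 2) := by gcongr
    have q3 := mul_le_mul_of_nonneg_left (e3.trans (add_le_add_right q2 _)) hr
    have q4 := mul_le_mul_of_nonneg_left e2 hr
    have q5 := mul_le_mul_of_nonneg_left e4 (zero_le_one.trans hs1)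
    rw [q1, e1]
    nlinarith
  have hn := h.le_card
  have hrn := h.mul_le_card
  have hsq := h.le_sq
  rw [← hs] at hn hsq
  set n : ℝ := (Fintype.card V : ℝ)
  exact le_of_mul_sq_le hk hs hn hrn hr hT0 hA hsq hrT

end IsLargeEigenpair

end SimpleGraph

/-! ### Two-step walks and the structure of the heavy set -/

namespace SimpleGraph

open Finset
open scoped Classical

variable {V : Type*} [Fintype V] {G : SimpleGraph V}

namespace IsLargeEigenpair

variable {k : ℕ} {r : ℝ} {x : V → ℝ}

/-- The total error in comparing two-step walks with walks through heavy vertices. -/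
noncomputable def walkError (G : SimpleGraph V) (k : ℕ) (r : ℝ) (x : V → ℝ) : ℝ :=
  r * ∑ v ∈ heavySet k x, x v + 1 / (16 * k) * G.adjPairs (heavySet k x)ᶜ (heavySet k x)ᶜ

/-- Two-step walks from `u` are sorted by type: light middle and heavy end is the main term; a heavy
middle, or a light middle with light end, goes into `walkError`. -/
lemma sq_mul_entry_le (h : G.IsLargeEigenpair k r x) (u : V) :
    r ^ 2 * x u ≤ ∑ w ∈ heavySet k x, G.codegIn (heavySet k x)ᶜ u w * x w +
      walkError G k r x := by
  have h1 : r ^ 2 * x u = r * ∑ v ∈ heavySet k x, G.adjInd u v * x v +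
      ∑ v ∈ (heavySet k x)ᶜ, G.adjInd u v * (r * x v) := by
    rw [sq, mul_assoc, h.sum_split u, mul_add, mul_sum (s := (heavySet k x)ᶜ)]
    congr 1
    exact sum_congr rfl fun _ _ => by ring
  have h2 : r * ∑ v ∈ heavySet k x, G.adjInd u v * x v ≤ r * ∑ v ∈ heavySet k x, x v :=
    mul_le_mul_of_nonneg_left (sum_le_sum fun v _ =>
      mul_le_of_le_one_left (h.entry_nonneg v) (G.adjInd_le_one _ _)) h.nonneg
  have h3 : ∑ v ∈ (heavySet k x)ᶜ, G.adjInd u v * (r * x v) ≤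
      ∑ w ∈ heavySet k x, G.codegIn (heavySet k x)ᶜ u w * x w +
        1 / (16 * k) * G.adjPairs (heavySet k x)ᶜ (heavySet k x)ᶜ := by
    rw [sum_codegIn_mul, adjPairs, mul_sum, ← sum_add_distrib]
    refine sum_le_sum fun v _ => ?_
    rw [h.sum_split v, mul_add]
    refine add_le_add_right ?_ _
    refine (mul_le_of_le_one_left ?_ (G.adjInd_le_one _ _)).trans (h.sum_compl_heavySet_le v)
    exact sum_nonneg fun w _ => mul_nonneg (G.adjInd_nonneg _ _) (h.entry_nonneg w)
  rw [walkError]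
  linarith

lemma sum_codegIn_mul_le (h : G.IsLargeEigenpair k r x) (u : V) (S R : Finset V) :
    ∑ w ∈ S, G.codegIn R u w * x w ≤ ∑ w ∈ S, G.codegIn R u w :=
  sum_le_sum fun w _ => mul_le_of_le_one_right (G.codegIn_nonneg _ _ _) (h.entry_le_one w)

lemma sum_codegIn_le (h : G.IsLargeEigenpair k r x) (u : V) :
    ∑ w ∈ heavySet k x, G.codegIn (heavySet k x)ᶜ u w ≤
      (2 * (k : ℝ) - 1) * (#(heavySet k x) + G.degIn (heavySet k x)ᶜ u) + 6 * (k : ℝ) ^ 2 := by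
  rw [sum_codegIn, degIn_eq_card]
  have hd : Disjoint {v ∈ (heavySet k x)ᶜ | G.Adj u v} (heavySet k x) :=
    disjoint_compl_left.mono_left (filter_subset _ _)
  have h1 := h.adjPairs_le hd
  have h2 := G.adjPairs_nonneg {v ∈ (heavySet k x)ᶜ | G.Adj u v} {v ∈ (heavySet k x)ᶜ | G.Adj u v}
  have h3 := G.adjPairs_nonneg (heavySet k x) (heavySet k x)
  linarith

/-- The numerical part of the bound on the total error. -/
lemma le_of_light_pairs_le {k s n r T a e : ℝ} (hk : 1 ≤ k) (hs : s = 2 * k - 1)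
    (hn : 230400 * s * k ^ 4 ≤ n) (hrn : 330 * k ^ 2 * r ≤ n) (hr : 0 ≤ r)
    (hT : T ≤ 5 / 4 * s) (ha : a ≤ 16 * k * T) (he0 : 0 ≤ e)
    (he : s * (n - s) + e / 2 ≤ s * n + 6 * k ^ 2 + (r * T + 1 / (16 * k) * e)) :
    100 * k * (s ^ 2 + s * a + 6 * k ^ 2 + (r * T + 1 / (16 * k) * e)) ≤ n := by
  have hs1 : 1 ≤ s := by linarith
  have hs2k : s ≤ 2 * k := by linarith
  have hs0 : 0 ≤ s := by linarith
  have hk0 : 0 < k := by linarith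
  have hη : k * (1 / (16 * k) * e) = e / 16 := by field_simp
  have hη' : 1 / (16 * k) * e ≤ e / 16 := by
    have : 1 / (16 * k) ≤ 1 / 16 := one_div_le_one_div_of_le (by norm_num) (by linarith)
    nlinarith
  have hk34 : k ^ 3 ≤ k ^ 4 := pow_le_pow_right₀ hk (by norm_num)
  have hk3 : k ^ 3 ≤ n / 230400 := by
    have : 1 * k ^ 3 ≤ s * k ^ 4 := mul_le_mul hs1 hk34 (by positivity) hs0
    linarith
  have hrT : k * (r * T) ≤ 5 / 2 * n / 330 := by
    have h1 : r * T ≤ r * (5 / 2 * k) := mul_le_mul_of_nonneg_left (by linarith) hr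
    have h2 := mul_le_mul_of_nonneg_left h1 hk0.le
    linarith
  have hss : k * s ^ 2 ≤ 4 * k ^ 3 := by
    have : s ^ 2 ≤ (2 * k) ^ 2 := pow_le_pow_left₀ hs0 hs2k 2
    have := mul_le_mul_of_nonneg_left this hk0.le
    linarith
  have hsa : k * (s * a) ≤ 40 * (n / 230400) := by
    have h1 : a ≤ 20 * k * s := by
      have := mul_le_mul_of_nonneg_left hT (by positivity : 0 ≤ 16 * k)
      linarith
    have h2 : k * (s * a) ≤ k * (s * (20 * k * s)) := by gcongr
    have h3 : k ^ 2 * (s * s) ≤ k ^ 2 * (s * (2 * k)) := by gcongr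
    have h4 : s * k ^ 3 ≤ s * k ^ 4 := mul_le_mul_of_nonneg_left hk34 hs0
    linarith
  have he1 : e * (7 / 16) ≤ s ^ 2 + 6 * k ^ 2 + r * T := by linarith
  have hee : e / 16 ≤ (s ^ 2 + 6 * k ^ 2 + r * T) / 7 := by linarith
  have hek : e / 16 ≤ k * (s ^ 2 + 6 * k ^ 2 + r * T) / 7 := by
    have h0 : 0 ≤ s ^ 2 + 6 * k ^ 2 + r * T := by linarith
    have := mul_le_mul_of_nonneg_right hk h0
    linarith
  have hn0 : 0 ≤ n := by
    have : 0 ≤ k ^ 3 := by positivity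
    linarith
  have hexp : k * (s ^ 2 + 6 * k ^ 2 + r * T) = k * s ^ 2 + 6 * k ^ 3 + k * (r * T) := by ring
  have hgoal : 100 * k * (s ^ 2 + s * a + 6 * k ^ 2 + (r * T + 1 / (16 * k) * e)) =
      100 * (k * s ^ 2 + k * (s * a) + 6 * k ^ 3 + k * (r * T) + k * (1 / (16 * k) * e)) := by
    ring
  rw [hgoal, hη]
  rw [hexp] at hek
  linarith

/-- At a vertex with entry `1`, `s(n - s)` is at most the number of light–heavy edges plus the
error, while those edges together with the light–light ones number at most `sn + 6k²`. Hence there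
are few light–light edges, and the error is itself controlled by them. -/
lemma error_le (h : G.IsLargeEigenpair k r x) :
    100 * (k : ℝ) * ((2 * (k : ℝ) - 1) ^ 2 + (2 * (k : ℝ) - 1) * #(heavySet k x) +
      6 * (k : ℝ) ^ 2 + walkError G k r x) ≤ Fintype.card V := by
  refine le_of_light_pairs_le h.one_le_cast rfl h.le_card h.mul_le_card h.nonneg
    h.sum_heavySet_le (card_heavySet_le k x) (G.adjPairs_nonneg _ _) ?_
  obtain ⟨u, hu⟩ := h.exists_entry_eq_one
  have h1 := h.sq_mul_entry_le u
  have h2 := h.sum_codegIn_mul_le u (heavySet k x) (heavySet k x)ᶜ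
  have h3 := G.adjPairs_mono (filter_subset (G.Adj u) (heavySet k x)ᶜ)
    (subset_refl (heavySet k x))
  rw [sum_codegIn] at h2
  have h4 := h.adjPairs_le (disjoint_compl_left : Disjoint (heavySet k x)ᶜ (heavySet k x))
  have h5 := G.adjPairs_nonneg (heavySet k x) (heavySet k x)
  have h6 := h.le_sq
  rw [hu, mul_one, walkError] at h1
  rw [← card_heavySet_add_card_compl k x] at h6 ⊢
  linarith

/-- A large entry forces a large light degree: the walks counted in `sq_mul_entry_le` number at most
about `s` times the light degree of `u`, and `r²` is about `sn` or more. -/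
lemma card_mul_entry_le (h : G.IsLargeEigenpair k r x) (u : V) :
    Fintype.card V * x u ≤ G.degIn (heavySet k x)ᶜ u + Fintype.card V / (100 * k) := by
  have hk := h.one_le_cast
  have h1 := h.sq_mul_entry_le u
  have h2 := h.sum_codegIn_mul_le u (heavySet k x) (heavySet k x)ᶜ
  have h3 := h.sum_codegIn_le u
  have h4 := h.error_le
  have h5 := mul_le_mul_of_nonneg_right h.le_sq (h.entry_nonneg u)
  have h6 := h.entry_le_one u
  set n : ℝ := (Fintype.card V : ℝ)
  set s : ℝ := 2 * (k : ℝ) - 1 with hs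
  have hs1 : 1 ≤ s := by linarith
  have h7 : s ^ 2 + s * #(heavySet k x) + 6 * (k : ℝ) ^ 2 + walkError G k r x ≤ n / (100 * k) := by
    rw [le_div_iff₀ (by positivity)]; linarith
  have h8 : s ^ 2 * x u ≤ s ^ 2 := mul_le_of_le_one_right (sq_nonneg _) h6
  have h9 : s * (n * x u) ≤ s * G.degIn (heavySet k x)ᶜ u + n / (100 * k) := by linarith
  have h10 : n / (100 * k) ≤ s * (n / (100 * k)) :=
    le_mul_of_one_le_left (by positivity) hs1
  refine le_of_mul_le_mul_left ?_ (zero_lt_one.trans_le hs1)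
  linarith

/-- At a vertex with entry `1` the walk count is almost tight, so replacing the heavy entries by `1`
can change it only by the error. -/
lemma sum_codegIn_mul_one_sub_le (h : G.IsLargeEigenpair k r x) {u : V} (hu : x u = 1) :
    ∑ w ∈ heavySet k x, G.codegIn (heavySet k x)ᶜ u w * (1 - x w) ≤
      Fintype.card V / (100 * k) := by
  have hk := h.one_le_cast
  have h1 := h.sq_mul_entry_le u
  have h3 := h.sum_codegIn_le u
  have h4 := h.error_le
  have h5 := h.le_sq
  have h6 := (G.degIn_le_card (heavySet k x)ᶜ u).trans
    (Nat.cast_le.2 (card_le_univ (heavySet k x)ᶜ))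
  rw [hu, mul_one] at h1
  rw [le_div_iff₀ (by positivity)]
  simp only [mul_sub, mul_one, sum_sub_distrib]
  set n : ℝ := (Fintype.card V : ℝ)
  set s : ℝ := 2 * (k : ℝ) - 1 with hs
  have hs1 : 1 ≤ s := by linarith
  have h7 := mul_le_mul_of_nonneg_left h6 (zero_le_one.trans hs1)
  have h8 : ∑ w ∈ heavySet k x, G.codegIn (heavySet k x)ᶜ u w -
      ∑ w ∈ heavySet k x, G.codegIn (heavySet k x)ᶜ u w * x w ≤
      s ^ 2 + s * #(heavySet k x) + 6 * (k : ℝ) ^ 2 + walkError G k r x := by linarith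
  have h9 := mul_le_mul_of_nonneg_right h8 (by positivity : 0 ≤ 100 * (k : ℝ))
  linarith

lemma codegIn_mul_one_sub_le (h : G.IsLargeEigenpair k r x) {u w : V} (hu : x u = 1)
    (hw : w ∈ heavySet k x) :
    G.codegIn (heavySet k x)ᶜ u w * (1 - x w) ≤ Fintype.card V / (100 * k) :=
  (single_le_sum (f := fun w => G.codegIn (heavySet k x)ᶜ u w * (1 - x w)) (fun w _ =>
    mul_nonneg (G.codegIn_nonneg _ _ _) (sub_nonneg.2 (h.entry_le_one w))) hw).trans
    (h.sum_codegIn_mul_one_sub_le hu)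

lemma card_pos (h : G.IsLargeEigenpair k r x) : (0 : ℝ) < Fintype.card V := by
  have hk := h.one_le_cast
  have : 0 < 230400 * (2 * (k : ℝ) - 1) * (k : ℝ) ^ 4 := by
    have : 0 < 2 * (k : ℝ) - 1 := by linarith
    positivity
  exact this.trans_le h.le_card

lemma codegIn_ge (h : G.IsLargeEigenpair k r x) {u : V} (hu : x u = 1) (w : V) :
    Fintype.card V * x w - 2 * (Fintype.card V / (100 * k)) ≤ G.codegIn (heavySet k x)ᶜ u w := by
  have h1 := degIn_add_degIn_sub_card_le_codegIn (G := G) (heavySet k x)ᶜ u w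
  have h2 := h.card_mul_entry_le u
  have h3 := h.card_mul_entry_le w
  have h4 : (#(heavySet k x)ᶜ : ℝ) ≤ Fintype.card V := by exact_mod_cast card_le_univ _
  rw [hu] at h2
  linarith

/-- A gap: an entry below `1/2` would force codegree at most `n/(50k)` with the top vertex, but
heaviness gives at least `n/(16k) - n/(50k)`. -/
lemma half_le_entry (h : G.IsLargeEigenpair k r x) {w : V} (hw : w ∈ heavySet k x) :
    1 / 2 ≤ x w := by
  obtain ⟨u, hu⟩ := h.exists_entry_eq_one
  have hk := h.one_le_cast
  have h1 := h.codegIn_mul_one_sub_le hu hw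
  have h2 := h.codegIn_ge hu w
  have hn := h.card_pos
  have hw' := (mem_filter.1 hw).2
  by_contra! hlt
  set n : ℝ := (Fintype.card V : ℝ)
  have he : 0 < n / k := by positivity
  have he' : n / (100 * k) = n / k / 100 := by rw [div_div, mul_comm (100 : ℝ)]
  have h3 : n / k / 16 ≤ n * x w := by
    rw [div_div, div_le_iff₀ (by positivity)]
    have := mul_le_mul_of_nonneg_left hw' hn.le
    linarith
  have h4 : 0 ≤ G.codegIn (heavySet k x)ᶜ u w := G.codegIn_nonneg _ _ _
  have h5 : G.codegIn (heavySet k x)ᶜ u w * (1 / 2) ≤ G.codegIn (heavySet k x)ᶜ u w * (1 - x w) :=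
    mul_le_mul_of_nonneg_left (by linarith) h4
  rw [he'] at h1 h2
  linarith

/-- Once the entry is at least `1/2`, the codegree with the top vertex is at least `0.48 n`. So the
entry is at least `1 - 1/(48k)`, and `1/48 + 1/100 ≤ 1/30`. -/
lemma degIn_heavy_ge (h : G.IsLargeEigenpair k r x) {w : V} (hw : w ∈ heavySet k x) :
    Fintype.card V - Fintype.card V / (30 * k) ≤ G.degIn (heavySet k x)ᶜ w := by
  obtain ⟨u, hu⟩ := h.exists_entry_eq_one
  have hk := h.one_le_cast
  have h1 := h.codegIn_mul_one_sub_le hu hw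
  have h2 := h.codegIn_ge hu w
  have hn := h.card_pos
  have hhalf := h.half_le_entry hw
  have h3 := h.card_mul_entry_le w
  have h6 := h.entry_le_one w
  set n : ℝ := (Fintype.card V : ℝ)
  have he : 0 < n / k := by positivity
  have hle : n / k ≤ n := div_le_self hn.le hk
  have he' : n / (100 * k) = n / k / 100 := by rw [div_div, mul_comm (100 : ℝ)]
  have he'' : n / (30 * k) = n / k / 30 := by rw [div_div, mul_comm (30 : ℝ)]
  rw [he'] at h1 h2 h3
  rw [he'']
  have h4 : 48 / 100 * n ≤ G.codegIn (heavySet k x)ᶜ u w := by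
    have := mul_le_mul_of_nonneg_left hhalf hn.le
    linarith
  have h5 := mul_le_mul_of_nonneg_right h4 (sub_nonneg.2 h6)
  linarith

/-- With at most `s - 1` heavy vertices, `r²` would be at most `(s - 1)n` plus an error too small to
reach `s(n - s)`. -/
lemma le_card_heavySet (h : G.IsLargeEigenpair k r x) : 2 * k - 1 ≤ #(heavySet k x) := by
  obtain ⟨u, hu⟩ := h.exists_entry_eq_one
  have hk := h.one_le_cast
  have h1 := h.sq_mul_entry_le u
  have h2 := h.sum_codegIn_mul_le u (heavySet k x) (heavySet k x)ᶜ
  have h3 : ∑ w ∈ heavySet k x, G.codegIn (heavySet k x)ᶜ u w ≤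
      #(heavySet k x) * Fintype.card V := by
    rw [← nsmul_eq_mul]
    refine sum_le_card_nsmul _ _ _ fun w _ => (G.codegIn_le_card _ _ _).trans ?_
    exact_mod_cast card_le_univ _
  have h4 := h.error_le
  have h5 := h.le_sq
  have hn := h.card_pos
  rw [hu, mul_one] at h1
  by_contra! hlt
  have hlt' : (#(heavySet k x) : ℝ) + 1 ≤ 2 * k - 1 := by
    have : #(heavySet k x) + 2 ≤ 2 * k := by omega
    have : (#(heavySet k x) : ℝ) + 2 ≤ 2 * k := by exact_mod_cast this
    linarith
  set n : ℝ := (Fintype.card V : ℝ)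
  set s : ℝ := 2 * (k : ℝ) - 1 with hs
  have hs1 : 1 ≤ s := by linarith
  have h7 : s ^ 2 + s * #(heavySet k x) + 6 * (k : ℝ) ^ 2 + walkError G k r x ≤ n / 100 := by
    have : s ^ 2 + s * #(heavySet k x) + 6 * (k : ℝ) ^ 2 + walkError G k r x ≤ n / (100 * k) := by
      rw [le_div_iff₀ (by positivity)]; linarith
    refine this.trans (div_le_div_of_nonneg_left hn.le (by norm_num) (by linarith))
  have h8 := mul_le_mul_of_nonneg_right hlt' hn.le
  have h9 : 0 ≤ s * #(heavySet k x) := by positivity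
  have h10 : 0 ≤ 6 * (k : ℝ) ^ 2 := by positivity
  linarith

lemma card_heavySet_mul_le (h : G.IsLargeEigenpair k r x) :
    100 * (#(heavySet k x) : ℝ) ≤ Fintype.card V := by
  have hk := h.one_le_cast
  have h4 := h.error_le
  have h5 : 0 ≤ walkError G k r x := by
    have := G.adjPairs_nonneg (heavySet k x)ᶜ (heavySet k x)ᶜ
    have h1 : 0 ≤ ∑ v ∈ heavySet k x, x v := sum_nonneg fun v _ => h.entry_nonneg v
    have := h.nonneg
    unfold walkError
    positivity
  have h6 : 1 * (#(heavySet k x) : ℝ) ≤ (2 * (k : ℝ) - 1) * #(heavySet k x) :=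
    mul_le_mul_of_nonneg_right (by linarith) (Nat.cast_nonneg _)
  have h7 : 0 ≤ (2 * (k : ℝ) - 1) ^ 2 := sq_nonneg _
  have h8 : 0 ≤ 6 * (k : ℝ) ^ 2 := by positivity
  have h9 : 1 * (#(heavySet k x) : ℝ) ≤ k * ((2 * (k : ℝ) - 1) ^ 2 +
      (2 * (k : ℝ) - 1) * #(heavySet k x) + 6 * (k : ℝ) ^ 2 + walkError G k r x) :=
    mul_le_mul hk (by linarith) (Nat.cast_nonneg _) (by linarith)
  linarith

/-- The heavy vertices have many common neighbours. -/
lemma card_common_neighbors_ge (h : G.IsLargeEigenpair k r x) {L : Finset V}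
    (hL : L ⊆ heavySet k x) (hLk : #L ≤ 2 * k) :
    2 * k + 2 ≤ #{v ∈ (heavySet k x)ᶜ | ∀ a ∈ L, G.Adj a v} := by
  have hk := h.one_le_cast
  set R := (heavySet k x)ᶜ with hR
  have h1 : (#R : ℝ) - ∑ a ∈ L, (#R - G.degIn R a) ≤ #{v ∈ R | ∀ a ∈ L, G.Adj a v} := by
    have hsub : R ⊆ {v ∈ R | ∀ a ∈ L, G.Adj a v} ∪ L.biUnion fun a => {v ∈ R | ¬ G.Adj a v} := by
      intro v hv
      simp only [mem_union, mem_filter, mem_biUnion, hv, true_and]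
      by_contra! hc
      obtain ⟨⟨a, ha, hav⟩, h2⟩ := hc
      exact hav (h2 a ha)
    have h2 := (card_le_card hsub).trans (card_union_le _ _)
    have h3 := h2.trans (Nat.add_le_add_left card_biUnion_le _)
    have h4 : ∀ a, (#{v ∈ R | ¬ G.Adj a v} : ℝ) = #R - G.degIn R a := fun a => by
      rw [degIn_eq_card, ← card_filter_add_card_filter_not (s := R) (fun v => G.Adj a v)]
      push_cast
      ring
    have h5 : (#R : ℝ) ≤ #{v ∈ R | ∀ a ∈ L, G.Adj a v} + ∑ a ∈ L, (#{v ∈ R | ¬ G.Adj a v} : ℝ) := by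
      exact_mod_cast h3
    simp only [h4] at h5
    linarith
  have h2 : ∑ a ∈ L, ((#R : ℝ) - G.degIn R a) ≤ #L * (Fintype.card V / (30 * k)) := by
    rw [← nsmul_eq_mul]
    refine sum_le_card_nsmul _ _ _ fun a ha => ?_
    have := h.degIn_heavy_ge (hL ha)
    have hRn : (#R : ℝ) ≤ Fintype.card V := by exact_mod_cast card_le_univ _
    linarith
  have h3 : (#L : ℝ) * (Fintype.card V / (30 * k)) ≤ Fintype.card V / 15 := by
    have : (#L : ℝ) ≤ 2 * k := by exact_mod_cast hLk
    refine (mul_le_mul_of_nonneg_right this (by positivity)).trans (le_of_eq ?_)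
    field_simp
    ring
  have h4 := card_heavySet_add_card_compl k x
  have h5 := h.card_heavySet_mul_le
  have h6 := h.le_card
  have hk4 : (k : ℝ) ≤ k ^ 4 := le_self_pow₀ hk (by norm_num)
  have h7 : 1 * (k : ℝ) ≤ (2 * (k : ℝ) - 1) * k ^ 4 :=
    mul_le_mul (by linarith) hk4 (by linarith) (by linarith)
  have : ((2 * k + 2 : ℕ) : ℝ) ≤ #{v ∈ R | ∀ a ∈ L, G.Adj a v} := by
    push_cast
    rw [← hR] at h4
    linarith
  exact_mod_cast this

/-- Any `2k` heavy vertices miss at most `n/15` light ones in total, so they would lie in a complete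
bipartite graph containing `k` disjoint quadrilaterals. -/
lemma card_heavySet_eq (h : G.IsLargeEigenpair k r x) : #(heavySet k x) = 2 * k - 1 := by
  refine le_antisymm ?_ h.le_card_heavySet
  by_contra! hlt
  obtain ⟨L, hL, hLc⟩ := exists_subset_card_eq (show 2 * k ≤ #(heavySet k x) by omega)
  have hZ := h.card_common_neighbors_ge hL hLc.le
  refine h.not_packing ((CyclicPacking.of_common_neighbors (j := k) (L := L)
    (Z := {v ∈ (heavySet k x)ᶜ | ∀ a ∈ L, G.Adj a v}) hLc.ge (by omega) ?_).mono (subset_univ _))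
  intro a ha z hz
  exact (mem_filter.1 hz).2 a ha

/-- The common neighbours of the heavy vertices among the light vertices. -/
noncomputable def commonSet (G : SimpleGraph V) (k : ℕ) (x : V → ℝ) : Finset V :=
  {v ∈ (heavySet k x)ᶜ | ∀ a ∈ heavySet k x, G.Adj a v}

lemma heavySet_nonempty (h : G.IsLargeEigenpair k r x) : (heavySet k x).Nonempty := by
  rw [← Finset.card_pos, h.card_heavySet_eq]
  have := h.one_le
  omega

/-- Outside such a `W` there remain `2k - 2` heavy vertices and at least `2k - 1` common neighbours,
enough for `k - 1` further disjoint quadrilaterals. -/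
lemma not_isCyclicSet (h : G.IsLargeEigenpair k r x) {W : Finset V}
    (hA : #(W ∩ heavySet k x) ≤ 1) (hN : #(W ∩ commonSet G k x) ≤ 3) : ¬ G.IsCyclicSet W := by
  intro hW
  have hk := h.one_le
  have h1 := h.card_heavySet_eq
  have h2 : 2 * k + 2 ≤ #(commonSet G k x) := h.card_common_neighbors_ge subset_rfl (by omega)
  have h3 : 2 * (k - 1) ≤ #(heavySet k x \ W) := by
    rw [card_sdiff]; omega
  have h4 : 2 * (k - 1) ≤ #(commonSet G k x \ W) := by
    rw [card_sdiff]; omega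
  have hp := (CyclicPacking.of_common_neighbors h3 h4 fun a ha z hz =>
    (mem_filter.1 (mem_sdiff.1 hz).1).2 a (mem_sdiff.1 ha).1).succ_of_disjoint hW
    (subset_univ _) (subset_univ _) ?_
  · rw [Nat.sub_add_cancel hk] at hp
    exact h.not_packing hp
  · rw [disjoint_union_right]
    exact ⟨disjoint_sdiff, disjoint_sdiff⟩

lemma not_adj_of_mem_commonSet (h : G.IsLargeEigenpair k r x) {u v : V}
    (hu : u ∈ commonSet G k x) (hv : v ∈ commonSet G k x) : ¬ G.Adj u v := by
  intro huv
  obtain ⟨a, ha⟩ := h.heavySet_nonempty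
  have hu' := mem_filter.1 hu
  have hv' := mem_filter.1 hv
  refine h.not_isCyclicSet (W := {a, u, v}) ?_ ?_
    (isCyclicSet_triangle (hu'.2 a ha) (hv'.2 a ha) huv)
  · refine (card_le_card (t := {a}) fun y hy => ?_).trans (card_singleton a).le
    simp only [mem_inter, mem_insert, mem_singleton] at hy ⊢
    rcases hy with ⟨rfl | rfl | rfl, hyA⟩
    · rfl
    · exact absurd hyA (mem_compl.1 hu'.1)
    · exact absurd hyA (mem_compl.1 hv'.1)
  · exact (card_le_card inter_subset_left).trans card_le_three

lemma degIn_commonSet_le_one (h : G.IsLargeEigenpair k r x) {v : V} (hv : v ∉ heavySet k x) :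
    G.degIn (commonSet G k x) v ≤ 1 := by
  rw [degIn_eq_card]
  by_contra! hlt
  obtain ⟨p, hp, q, hq, hpq⟩ := one_lt_card.1
    (show 1 < #{w ∈ commonSet G k x | G.Adj v w} by exact_mod_cast hlt)
  rw [mem_filter] at hp hq
  obtain ⟨a, ha⟩ := h.heavySet_nonempty
  have hp' := mem_filter.1 hp.1
  have hq' := mem_filter.1 hq.1
  refine h.not_isCyclicSet (W := {a, v, p, q}) ?_ ?_ (isCyclicSet_square
    (fun e => hv (e ▸ ha)) hpq (hp'.2 a ha) (hq'.2 a ha) hp.2 hq.2)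
  · refine (card_le_card (t := {a}) fun y hy => ?_).trans (card_singleton a).le
    simp only [mem_inter, mem_insert, mem_singleton] at hy ⊢
    rcases hy with ⟨rfl | rfl | rfl | rfl, hyA⟩
    · rfl
    · exact absurd hyA hv
    · exact absurd hyA (mem_compl.1 hp'.1)
    · exact absurd hyA (mem_compl.1 hq'.1)
  · refine (card_le_card (t := {v, p, q}) fun y hy => ?_).trans card_le_three
    simp only [mem_inter, mem_insert, mem_singleton] at hy ⊢
    rcases hy with ⟨rfl | hy, hyN⟩
    · exact absurd ha (mem_compl.1 (mem_filter.1 hyN).1)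
    · exact hy

end IsLargeEigenpair

end SimpleGraph

/-! ### Comparison of quadratic forms and conclusion -/

namespace SimpleGraph

open Finset
open scoped Classical

variable {V : Type*}

/-- The contribution of `S ×ˢ T` to the quadratic form of the adjacency matrix. -/
noncomputable def pairForm (G : SimpleGraph V) (x : V → ℝ) (S T : Finset V) : ℝ :=
  ∑ u ∈ S, ∑ v ∈ T, G.adjInd u v * (x u * x v)

variable (G : SimpleGraph V) (x : V → ℝ)

lemma pairForm_comm (S T : Finset V) : G.pairForm x S T = G.pairForm x T S := by
  rw [pairForm, pairForm, sum_comm]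
  exact sum_congr rfl fun u _ => sum_congr rfl fun v _ => by rw [adjInd_comm, mul_comm (x v)]

lemma pairForm_union_left {S T : Finset V} (h : Disjoint S T) (U : Finset V) :
    G.pairForm x (S ∪ T) U = G.pairForm x S U + G.pairForm x T U := sum_union h

lemma pairForm_union_self {S T : Finset V} (h : Disjoint S T) :
    G.pairForm x (S ∪ T) (S ∪ T) =
      G.pairForm x S S + 2 * G.pairForm x S T + G.pairForm x T T := by
  rw [pairForm_union_left G x h, G.pairForm_comm x S, G.pairForm_comm x T,
    pairForm_union_left G x h, pairForm_union_left G x h, G.pairForm_comm x T S]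
  ring

lemma pairForm_singleton_self (v : V) : G.pairForm x {v} {v} = 0 := by
  simp [pairForm, adjInd_self]

lemma pairForm_eq_zero {S T : Finset V} (h : ∀ u ∈ S, ∀ v ∈ T, ¬ G.Adj u v) :
    G.pairForm x S T = 0 :=
  sum_eq_zero fun u hu => sum_eq_zero fun v hv => by
    rw [adjInd_of_not_adj (h u hu v hv), zero_mul]

variable {G x}

lemma pairForm_le_of_degIn_le {S T : Finset V} {d M : ℝ} (hx : ∀ v ∈ S, 0 ≤ x v)
    (hd : ∀ u ∈ S, G.degIn T u ≤ d) (hM0 : 0 ≤ M) (hM : ∀ v ∈ T, x v ≤ M) :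
    G.pairForm x S T ≤ d * M * ∑ u ∈ S, x u := by
  rw [mul_sum]
  refine sum_le_sum fun u hu => ?_
  have h1 : ∑ v ∈ T, G.adjInd u v * (x u * x v) ≤ G.degIn T u * (M * x u) := by
    rw [degIn, sum_mul]
    refine sum_le_sum fun v hv => mul_le_mul_of_nonneg_left ?_ (G.adjInd_nonneg _ _)
    rw [mul_comm]
    exact mul_le_mul_of_nonneg_right (hM v hv) (hx u hu)
  have h2 := mul_le_mul_of_nonneg_right (hd u hu) (mul_nonneg hM0 (hx u hu))
  linarith

/-- The quadratic form on a `d`-degenerate set of small entries. -/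
lemma pairForm_self_le_of_degenerate {d M : ℝ} (hM0 : 0 ≤ M) {S : Finset V}
    (hx : ∀ v ∈ S, 0 ≤ x v) (hM : ∀ v ∈ S, x v ≤ M)
    (hd : ∀ T ⊆ S, T.Nonempty → ∃ v ∈ T, G.degIn T v ≤ d) :
    G.pairForm x S S ≤ 2 * d * M * ∑ u ∈ S, x u := by
  induction S using Finset.strongInduction with
  | H S ih =>
    rcases S.eq_empty_or_nonempty with rfl | hne
    · simp [pairForm]
    -- Peeling off a vertex of degree at most `d` accounts for at most `2dM x_v` of the form.
    obtain ⟨v, hv, hvd⟩ := hd S subset_rfl hne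
    have hsub := erase_subset v S
    have h1 := ih (S.erase v) (erase_ssubset hv) (fun w hw => hx w (hsub hw))
      (fun w hw => hM w (hsub hw)) fun T hT => hd T (hT.trans hsub)
    have hdis : Disjoint {v} (S.erase v) := by simp
    have h2 := pairForm_union_self G x hdis
    rw [← insert_eq, insert_erase hv] at h2
    have h3 : G.pairForm x {v} (S.erase v) ≤ d * M * ∑ u ∈ {v}, x u :=
      pairForm_le_of_degIn_le (by simpa using hx v hv)
        (by simpa using (G.degIn_mono hsub v).trans hvd) hM0 fun w hw => hM w (hsub hw)
    rw [sum_singleton] at h3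
    rw [h2, pairForm_singleton_self, ← add_sum_erase S x hv]
    linarith

variable [Fintype V]

lemma adjForm_eq_pairForm (G : SimpleGraph V) (x : V → ℝ) (S : Finset V) :
    G.adjForm x = G.pairForm x S S + 2 * G.pairForm x S Sᶜ + G.pairForm x Sᶜ Sᶜ := by
  rw [← pairForm_union_self G x disjoint_compl_right, union_compl]
  rfl

namespace IsLargeEigenpair

variable {k : ℕ} {r : ℝ}

/-- Comparison of the quadratic form of `G` with that of the complete split graph. -/
lemma adjForm_add_le (h : G.IsLargeEigenpair k r x) :
    G.adjForm x + 1 / 8 * ∑ v ∈ (heavySet k x)ᶜ \ commonSet G k x, x v ≤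
      (splitOn (heavySet k x)).adjForm x := by
  have hk := h.one_le_cast
  set A := heavySet k x with hA
  set N := commonSet G k x with hN
  set B := Aᶜ \ N with hB
  have hNA : N ⊆ Aᶜ := filter_subset _ _
  have hη : (0 : ℝ) ≤ 1 / (16 * k) := by positivity
  have hlight : ∀ v ∈ Aᶜ, x v ≤ 1 / (16 * k) := fun v hv => h.entry_lt (mem_compl.1 hv)
  have hBA : B ⊆ Aᶜ := sdiff_subset
  have hsB : 0 ≤ ∑ v ∈ B, x v := sum_nonneg fun v _ => h.entry_nonneg v
  have hAA : G.pairForm x A A ≤ (splitOn A).pairForm x A A := by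
    refine sum_le_sum fun u hu => sum_le_sum fun v hv => ?_
    refine mul_le_mul_of_nonneg_right ?_ (mul_nonneg (h.entry_nonneg u) (h.entry_nonneg v))
    by_cases huv : u = v
    · subst huv; rw [adjInd_self, adjInd_self]
    · rw [adjInd_of_adj (G := splitOn A) ⟨huv, Or.inl hu⟩]
      exact G.adjInd_le_one _ _
  have hAR : G.pairForm x Aᶜ A + 1 / 2 * ∑ v ∈ B, x v ≤ (splitOn A).pairForm x Aᶜ A := by
    have hBsum : ∑ v ∈ B, x v = ∑ v ∈ Aᶜ, if v ∈ N then 0 else x v := by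
      rw [hB, ← filter_notMem_eq_sdiff, sum_filter]
      exact sum_congr rfl fun v _ => by by_cases hv : v ∈ N <;> simp [hv]
    rw [hBsum, mul_sum, pairForm, ← sum_add_distrib]
    refine sum_le_sum fun v hv => ?_
    have hvA := mem_compl.1 hv
    have hS : ∀ a ∈ A, (splitOn A).adjInd v a = 1 := fun a ha =>
      adjInd_of_adj ⟨fun e => hvA (e ▸ ha), Or.inr ha⟩
    have hle : ∀ a ∈ A, G.adjInd v a * (x v * x a) ≤ (splitOn A).adjInd v a * (x v * x a) := by
      intro a ha
      rw [hS a ha]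
      exact mul_le_mul_of_nonneg_right (G.adjInd_le_one _ _)
        (mul_nonneg (h.entry_nonneg v) (h.entry_nonneg a))
    by_cases hvN : v ∈ N
    · rw [if_pos hvN, mul_zero, add_zero]
      exact sum_le_sum hle
    · rw [if_neg hvN]
      -- A light vertex outside `N` misses some heavy `a`; adding that edge gains `x_v x_a ≥ x_v /
      -- 2`.
      have : ∃ a ∈ A, ¬ G.Adj a v := by
        by_contra! hc
        exact hvN (mem_filter.2 ⟨hv, hc⟩)
      obtain ⟨a, ha, hav⟩ := this
      rw [← add_sum_erase A _ ha, ← add_sum_erase A _ ha, hS a ha,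
        adjInd_of_not_adj fun e => hav e.symm]
      have h1 := sum_le_sum fun b (hb : b ∈ A.erase a) => hle b (mem_of_mem_erase hb)
      have h2 := mul_le_mul_of_nonneg_left (h.half_le_entry ha) (h.entry_nonneg v)
      linarith
  have hRR : G.pairForm x Aᶜ Aᶜ ≤ 7 / 8 * ∑ v ∈ B, x v := by
    have hunion : Aᶜ = B ∪ N := (sdiff_union_of_subset hNA).symm
    have h1 : G.pairForm x N N = 0 :=
      pairForm_eq_zero G x fun u hu v hv => h.not_adj_of_mem_commonSet hu hv
    have h2 : G.pairForm x B N ≤ 1 * (1 / (16 * k)) * ∑ v ∈ B, x v :=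
      pairForm_le_of_degIn_le (fun v _ => h.entry_nonneg v)
        (fun v hv => h.degIn_commonSet_le_one (mem_compl.1 (hBA hv))) hη
        fun v hv => hlight v (hNA hv)
    have h3 : G.pairForm x B B ≤ 2 * (6 * k) * (1 / (16 * k)) * ∑ v ∈ B, x v :=
      pairForm_self_le_of_degenerate hη (fun v _ => h.entry_nonneg v)
        (fun v hv => hlight v (hBA hv)) fun T _ hT => by
          obtain ⟨v, hv, hvd⟩ := exists_degIn_lt_of_not_cyclicPacking h.one_le
            (subset_univ T) h.not_packing hT
          exact ⟨v, hv, hvd.le⟩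
    -- The threshold `1/(16k)` matters here: `6k`-degeneracy costs `3/4`, and the `B`–`N` edges,
    -- counted twice, cost at most `1/8`.
    have h4 : 2 * (6 * (k : ℝ)) * (1 / (16 * k)) = 3 / 4 := by field_simp; norm_num
    have h5 := mul_le_mul_of_nonneg_right h.light_coeff_le hsB
    rw [h4] at h3
    rw [hunion, pairForm_union_self G x sdiff_disjoint, h1]
    linarith
  have hRR' : (splitOn A).pairForm x Aᶜ Aᶜ = 0 :=
    pairForm_eq_zero _ x fun u hu v hv e => e.2.elim (mem_compl.1 hu) (mem_compl.1 hv)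
  -- The gain is twice `1/2`, the loss at most `7/8`, leaving `1/8`.
  rw [adjForm_eq_pairForm G x A, adjForm_eq_pairForm (splitOn A) x A, hRR',
    G.pairForm_comm x A Aᶜ, (splitOn A).pairForm_comm x A Aᶜ]
  linarith

/-- If the eigenvalue is at least that of the complete split graph, then `G` is that graph. -/
lemma eq_splitOn (h : G.IsLargeEigenpair k r x) {t : ℝ} (htr : t ≤ r)
    (hle : ∀ z, (splitOn (heavySet k x)).adjForm z ≤ t * ∑ v, z v ^ 2)
    (heq : ∀ z, (splitOn (heavySet k x)).adjForm z = t * ∑ v, z v ^ 2 →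
      ∀ v, ∑ w, (splitOn (heavySet k x)).adjInd v w * z w = t * z v) :
    G = splitOn (heavySet k x) := by
  have hform : G.adjForm x = r * ∑ v, x v ^ 2 := by
    rw [adjForm, mul_sum]
    refine sum_congr rfl fun u _ => ?_
    have := h.eigen u
    calc ∑ v, G.adjInd u v * (x u * x v) = x u * ∑ v, G.adjInd u v * x v := by
          rw [mul_sum]; exact sum_congr rfl fun _ _ => by ring
      _ = r * x u ^ 2 := by rw [this]; ring
  have h1 := h.adjForm_add_le
  have h2 := hle x
  have h3 : t * ∑ v, x v ^ 2 ≤ r * ∑ v, x v ^ 2 :=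
    mul_le_mul_of_nonneg_right htr (sum_nonneg fun v _ => sq_nonneg _)
  have h4 : 0 ≤ ∑ v ∈ (heavySet k x)ᶜ \ commonSet G k x, x v :=
    sum_nonneg fun v _ => h.entry_nonneg v
  -- The form of the split graph at `x` is squeezed between `r ∑ x²` and `t ∑ x²` with `t ≤ r`, so
  -- every inequality is an equality and `x` is an eigenvector of the split graph as well.
  have h5 : (splitOn (heavySet k x)).adjForm x = t * ∑ v, x v ^ 2 := by linarith
  have h6 : ∑ v ∈ (heavySet k x)ᶜ \ commonSet G k x, x v = 0 := by linarith
  have h7 : G.adjForm x = (splitOn (heavySet k x)).adjForm x := by linarith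
  obtain ⟨a, ha⟩ := h.heavySet_nonempty
  have hxa : 0 < x a := by linarith [h.half_le_entry ha]
  -- In the split graph the heavy vertex `a` is adjacent to every other vertex, so no entry of this
  -- eigenvector vanishes.
  have hpos : ∀ v, 0 < x v := by
    intro v
    by_cases hva : v = a
    · rwa [hva]
    · have h8 := heq x h5 v
      have h9 : x a ≤ ∑ w, (splitOn (heavySet k x)).adjInd v w * x w := by
        have := single_le_sum (f := fun w => (splitOn (heavySet k x)).adjInd v w * x w)
          (fun w _ => mul_nonneg ((splitOn _).adjInd_nonneg v w) (h.entry_nonneg w)) (mem_univ a)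
        rwa [adjInd_of_adj (G := splitOn (heavySet k x)) ⟨hva, Or.inr ha⟩, one_mul] at this
      refine (h.entry_nonneg v).lt_of_ne fun e => ?_
      rw [← e, mul_zero] at h8
      linarith
  have hB : (heavySet k x)ᶜ ⊆ commonSet G k x := by
    intro v hv
    by_contra hvN
    have := (sum_eq_zero_iff_of_nonneg fun v _ => h.entry_nonneg v).1 h6 v
      (mem_sdiff.2 ⟨hv, hvN⟩)
    exact (hpos v).ne' this
  have hGle : ∀ u v, G.Adj u v → (splitOn (heavySet k x)).Adj u v := by
    intro u v huv
    refine ⟨huv.ne, ?_⟩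
    by_contra! hc
    exact h.not_adj_of_mem_commonSet (hB (mem_compl.2 hc.1)) (hB (mem_compl.2 hc.2)) huv
  have hind : ∀ u v, G.adjInd u v * (x u * x v) ≤
      (splitOn (heavySet k x)).adjInd u v * (x u * x v) := by
    intro u v
    refine mul_le_mul_of_nonneg_right ?_ (mul_nonneg (hpos u).le (hpos v).le)
    by_cases huv : G.Adj u v
    · rw [adjInd_of_adj huv, adjInd_of_adj (hGle u v huv)]
    · rw [adjInd_of_not_adj huv]
      exact (splitOn _).adjInd_nonneg _ _
  ext u v
  refine ⟨hGle u v, fun huv => ?_⟩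
  have h8 := (sum_eq_sum_iff_of_le fun u _ => sum_le_sum fun v _ => hind u v).1 h7 u (mem_univ u)
  have h9 := (sum_eq_sum_iff_of_le fun v _ => hind u v).1 h8 v (mem_univ v)
  have h10 := mul_right_cancel₀ (mul_pos (hpos u) (hpos v)).ne' h9
  by_contra hn
  rw [adjInd_of_adj huv, adjInd_of_not_adj hn] at h10
  exact zero_ne_one h10

end IsLargeEigenpair

/-- A graph without `k` disjoint cycles whose spectral radius is at least that of the complete
split graph is the complete split graph. -/
theorem nonempty_iso_completeSplitGraph_of_le {k : ℕ} (hk : 1 ≤ k)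
    (hn : 230400 * (2 * (k : ℝ) - 1) * (k : ℝ) ^ 4 ≤ Fintype.card V)
    (hG : ¬ G.HasIndependentCycles k)
    (hle : (completeSplitGraph (Fintype.card V) (2 * k - 1)).adjSpectralRadius ≤
      G.adjSpectralRadius) :
    Nonempty (G ≃g completeSplitGraph (Fintype.card V) (2 * k - 1)) := by
  have hk1 : (1 : ℝ) ≤ k := by exact_mod_cast hk
  have hk4 : (k : ℝ) ≤ k ^ 4 := le_self_pow₀ hk1 (by norm_num)
  have hsc : ((2 * k - 1 : ℕ) : ℝ) = 2 * (k : ℝ) - 1 := by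
    rw [Nat.cast_sub (by omega)]; push_cast; ring
  have hs1 : (1 : ℝ) ≤ 2 * (k : ℝ) - 1 := by linarith
  have hsn : 2 * (k : ℝ) - 1 < Fintype.card V := by
    have h1 : 1 ≤ (k : ℝ) ^ 4 := one_le_pow₀ hk1
    have := mul_le_mul_of_nonneg_left h1 (zero_le_one.trans hs1)
    linarith
  have : Nonempty V := by
    rw [← Fintype.card_pos_iff]
    have : (0 : ℝ) < Fintype.card V := by linarith
    exact_mod_cast this
  obtain ⟨r, hr0, hr, -, -, y, hy0, hyne, hy⟩ := G.exists_adjSpectralRadius_eq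
  have hsn' : 2 * k - 1 ≤ #(univ : Finset V) := by
    rw [card_univ]
    have : ((2 * k - 1 : ℕ) : ℝ) ≤ Fintype.card V := by rw [hsc]; exact hsn.le
    exact_mod_cast this
  obtain ⟨L, -, hL⟩ := exists_subset_card_eq hsn'
  have hrad : ∀ (A : Finset V), #A = 2 * k - 1 → (splitOn A).adjSpectralRadius =
      (completeSplitGraph (Fintype.card V) (2 * k - 1)).adjSpectralRadius := fun A hA => by
    obtain ⟨f⟩ := nonempty_splitOn_iso rfl A hA
    exact f.adjSpectralRadius_eq
  have hsq : (2 * (k : ℝ) - 1) * (Fintype.card V - (2 * (k : ℝ) - 1)) ≤ r ^ 2 := by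
    obtain ⟨t, ht0, ht, htle, -⟩ := (splitOn L).exists_adjSpectralRadius_eq
    have htr : t ≤ r := by
      rw [← hrad L hL, ht, hr] at hle
      exact (ENNReal.ofReal_le_ofReal_iff hr0).1 hle
    have hLc : (#Lᶜ : ℝ) = Fintype.card V - (2 * (k : ℝ) - 1) := by
      have : (#L : ℝ) + #Lᶜ = Fintype.card V := by exact_mod_cast card_add_card_compl L
      rw [hL, hsc] at this
      linarith
    -- The test vector is the Perron eigenvector of the complete bipartite graph between `L` and its
    -- complement, whose spectral radius is `√(s(n - s))`.
    have h1 := sum_sq_mul_le_adjForm_splitOn (L := L) √(#Lᶜ : ℝ) √(#L : ℝ)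
    have h2 := h1.trans (htle _)
    have h3 : ∑ v, (if v ∈ L then √(#Lᶜ : ℝ) else √(#L : ℝ)) ^ 2 = 2 * (#L : ℝ) * #Lᶜ := by
      have : ∀ v, (if v ∈ L then √(#Lᶜ : ℝ) else √(#L : ℝ)) ^ 2 =
          if v ∈ L then (#Lᶜ : ℝ) else #L := fun v => by
        split_ifs <;> exact Real.sq_sqrt (Nat.cast_nonneg _)
      simp only [this]
      rw [← sum_add_sum_compl L, sum_congr rfl fun v hv => if_pos hv,
        sum_congr (s₁ := Lᶜ) rfl fun v hv => if_neg (mem_compl.1 hv), sum_const, sum_const,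
        nsmul_eq_mul, nsmul_eq_mul]
      ring
    rw [h3, hL, hLc, hsc, mul_comm t] at h2
    have hpos : 0 < 2 * (2 * (k : ℝ) - 1) * (Fintype.card V - (2 * (k : ℝ) - 1)) :=
      mul_pos (by linarith) (by linarith)
    have h4 := (mul_le_mul_iff_right₀ hpos).1 h2
    rw [← Real.sqrt_mul (by linarith)] at h4
    have h5 := Real.sqrt_le_iff.1 (h4.trans htr)
    linarith [h5.2]
  obtain ⟨u, -, hu⟩ := exists_max_image univ y univ_nonempty
  have hyu : 0 < y u := by
    obtain ⟨v, hv⟩ := Function.ne_iff.1 hyne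
    exact ((hy0 v).lt_of_ne' hv).trans_le (hu v (mem_univ v))
  -- The eigenvector is scaled so that its largest entry is `1`.
  have hpair : G.IsLargeEigenpair k r fun v => y v / y u :=
    { one_le := hk
      le_card := hn
      nonneg := hr0
      le_sq := hsq
      entry_nonneg := fun v => div_nonneg (hy0 v) hyu.le
      entry_le_one := fun v => (div_le_one hyu).2 (hu v (mem_univ v))
      eigen := fun v => by
        simp only [mul_div_assoc']
        rw [← sum_div, hy v]
      exists_entry_eq_one := ⟨u, div_self hyu.ne'⟩
      not_packing := fun hp => hG hp.hasIndependentCycles }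
  obtain ⟨t, ht0, ht, htle, hteq, -⟩ :=
    (splitOn (heavySet k fun v => y v / y u)).exists_adjSpectralRadius_eq
  have htr : t ≤ r := by
    rw [← hrad _ hpair.card_heavySet_eq, ht, hr] at hle
    exact (ENNReal.ofReal_le_ofReal_iff hr0).1 hle
  have hGeq := hpair.eq_splitOn htr htle hteq
  obtain ⟨f⟩ := nonempty_splitOn_iso rfl _ hpair.card_heavySet_eq
  rw [← hGeq] at f
  exact ⟨f⟩

end SimpleGraph

theorem theorem1p2 (k n : ℕ) (hk : 1 ≤ k) (lam : ℝ) (hlam : lam = 1 / (120 * (k : ℝ) ^ 2))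
    (hn : 16 * (2 * (k : ℝ) - 1) / lam ^ 2 ≤ (n : ℝ))
    {V : Type*} [Fintype V] (hV : Fintype.card V = n) (G : SimpleGraph V)
    (hG : ¬ G.HasIndependentCycles k) :
    G.adjSpectralRadius ≤ (SimpleGraph.completeSplitGraph n (2 * k - 1)).adjSpectralRadius ∧
      (G.adjSpectralRadius = (SimpleGraph.completeSplitGraph n (2 * k - 1)).adjSpectralRadius ↔
        Nonempty (G ≃g SimpleGraph.completeSplitGraph n (2 * k - 1))) := by
  subst hV
  have hk1 : (1 : ℝ) ≤ k := by exact_mod_cast hk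
  -- With `λ = 1/(120k²)`, `16 / λ² = 16 · 120² k⁴ = 230400 k⁴`.
  have hn' : 230400 * (2 * (k : ℝ) - 1) * (k : ℝ) ^ 4 ≤ Fintype.card V := by
    refine le_trans (le_of_eq ?_) hn
    rw [hlam]
    field_simp
    ring
  have key := SimpleGraph.nonempty_iso_completeSplitGraph_of_le hk hn' hG
  have hiso : Nonempty (G ≃g SimpleGraph.completeSplitGraph (Fintype.card V) (2 * k - 1)) →
      G.adjSpectralRadius = (SimpleGraph.completeSplitGraph (Fintype.card V)
        (2 * k - 1)).adjSpectralRadius := fun ⟨f⟩ => f.adjSpectralRadius_eq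
  refine ⟨?_, fun h => key h.ge, hiso⟩
  -- A strictly larger spectral radius would already make `G` isomorphic to the split graph, and
  -- then the two radii agree.
  by_contra! hlt
  exact hlt.ne' (hiso (key hlt.le))
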